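/- **DTDs and trees.** A (non-recursive, structured) DTD $D$ consists of a finite set of element types, a root type $rt$, and for each element type $A$ a production rule $A\to Rg(A)$, where $Rg(A)$ is one of $\mathsf{str}$ (text), $\epsilon$, $B_1,\dots,B_n$ (concatenation), $B_1+\dots+B_n$ (disjunction), $B^*$, with $n\ge 1$ and distinct element types $B_i$. The $B_i$ occurring in $Rg(A)$ are the subelement types (successors) of $A$; the subelement relation is acyclic and $\le_D$ is its reflexive transitive closure. An instance of $D$ is a finite rooted unordered tree whose nodes are labelled by element types or by $\mathsf{str}$, whose root has label $rt$, in which the labels of the children of every node labelled $A$ form, in some order, a word of the language of $Rg(A)$, and whose $\mathsf{str}$-nodes are leaves carrying a string value. Instances at $B$ are defined in the same way with $B$ in place of $rt$. Trees are compared up to isomorphism ($\equiv$). **Policies.** The valid update access types (UATs) of $D$ are $(A,\mathsf{insert}(B))$ and $(A,\mathsf{delete}(B))$ for $Rg(A)=B^*$; $(A,\mathsf{replace}(B_i,B_j))$, $i\ne j$, for $Rg(A)=B_1+\dots+B_n$; and $(A,\mathsf{replace}(\mathsf{str},\mathsf{str}))$ for $Rg(A)=\mathsf{str}$. They are matched by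 the atomic updates that insert an instance at $B$ as a child of an $A$-node; delete the subtree at a $B$-child of an $A$-node; replace the subtree at a $B_i$-child of an $A$-node by an instance at $B_j$; change the string at a text child of an $A$-node. A policy over $D$ is a pair $P=(\mathcal A,\mathcal F)$ of disjoint sets of valid UATs (allowed, forbidden). It is total if $\mathcal A\cup\mathcal F=\mathrm{valid}(D)$, the set of all valid UATs, and partial otherwise. $P$ is consistent if there are no instance $t$ of $D$, update $op_0$ of $t$ matching a UAT in $\mathcal F$ with $op_0(t)\not\equiv t$, and sequence of updates, each matching a UAT in $\mathcal A$ on the tree to which it is applied, leading from $t$ to a tree isomorphic to $op_0(t)$. A policy $P'=(\mathcal A',\mathcal F')$ over $D$ is a repair of $P$ if it is consistent and $P'\le P$, i.e. $\mathcal A'\subseteq\mathcal A$. A repair is total if $\mathcal F'=\mathrm{valid}(D)\setminus\mathcal A'$, and partial otherwise. **Algorithm Repair.** Input: $D$, $P=(\mathcal A,\mathcal F)$, an integer $\mathrm{MNJ}\ge 0$, a Boolean *total*. Every element type $A$ is marked $-$ if some UAT $(C,\cdot)$ with $A\le_D C$ is in $\mathcal F$, and $+$ otherwise (the marks are computed bottom-up).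 * *InsDelRepair*: for each $A$ marked $-$ with $Rg(A)=B^*$ and $(A,\mathsf{insert}(B)),(A,\mathsf{delete}(B))\in\mathcal A$, output one of these two UATs, chosen arbitrarily. * *ReplaceRepair*: traverse the DTD graph from the root (a type is visited once for each path from the root to it). At each visit of a type $A$ with $Rg(A)=B_1+\dots+B_n$, let $G$ be the graph on $B_1,\dots,B_n$ with edges $(B_i,B_j)$ for $(A,\mathsf{replace}(B_i,B_j))\in\mathcal A$, compute a set $\mathcal C$ of edges as follows, and output $(A,\mathsf{replace}(X,Y))$ for all $(X,Y)\in\mathcal C$. * $\mathrm{MNJ}=0$ (naive algorithm): start with $\mathcal C=\emptyset$ and a stack of all vertices. While the stack is non-empty, pop $Y$ and run through all pairs of vertices $(X,Z)$: whenever $(X,Y),(Y,Z)\in G\setminus\mathcal C$ and either $X\ne Z$ and $(X,Z)\notin G\setminus\mathcal C$, or $X=Z$ and $X$ is marked $-$, put an arbitrary one of $(X,Y),(Y,Z)$ into $\mathcal C$ and push all vertices reachable in $G$ from its source. * $\mathrm{MNJ}>0$ (set cover algorithm): start with $\mathcal C=\emptyset$. Repeat: compute the transitive closure of the current $G$ by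 the Floyd–Warshall algorithm, recording at most $\mathrm{MNJ}$ justifications (sets of edges of $G$) for every edge, namely $\{e\}$ for an edge $e$ of $G$, and unions of a justification of $(X,Y)$ and one of $(Y,Z)$ for an added edge $(X,Z)$ with $X\ne Z$; and likewise for every vertex $X$ marked $-$ that is found on a cycle, as unions of a justification of $(X,Y)$ and one of $(Y,X)$. Let $U$ be the set of all justifications of vertices and of forbidden edges, i.e. edges $(X,Z)$ with $(A,\mathsf{replace}(X,Z))\in\mathcal F$ or $(X,Z)\in\mathcal C$. Run a set cover algorithm (exact or approximate, e.g. greedy) that selects edges of $G$ meeting every member of $U$, each selected edge lying in some member of $U$. If nothing is selected, stop; otherwise move the selected edges from $G$ to $\mathcal C$. Repair returns $P'=(\mathcal A',\mathcal F')$, where $\mathcal A'$ is $\mathcal A$ without all UATs output by InsDelRepair and ReplaceRepair, and $\mathcal F'=\mathrm{valid}(D)\setminus\mathcal A'$ if *total* is true, $\mathcal F'=\mathcal F$ if *total* is false. **Theorem.** Let $P$ be a policy over $D$ and $\mathrm{MNJ}\ge 0$. For all arbitrary choices in the run (and every set cover algorithm as above), Repair terminates, and: 1. if $P$ is total, then Repair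 with *total* true returns a total repair of $P$; 2. if $P$ is partial, then Repair with *total* false returns a partial repair $P'$ of $P$, with $\mathcal F'=\mathcal F$. In particular, the returned policy is consistent and below $P$ in the privilege order. -/

import Mathlib

namespace XMLRepair

/-! ### Document type definitions -/

/-- Right-hand sides of production rules: text content, empty content, a concatenation
`B₁, …, Bₙ`, a disjunction `B₁ + ⋯ + Bₙ`, or `B*`. -/
inductive Content (L : Type*) where
  | text : Content L
  | empty : Content L
  | seq (l : List L) : Content L
  | alt (l : List L) : Content L
  | star (b : L) : Content L

/-- The subelement types occurring in a right-hand side. -/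
def Content.subs {L : Type*} : Content L → List L
  | .text => []
  | .empty => []
  | .seq l => l
  | .alt l => l
  | .star b => [b]

/-- Labels of tree nodes: element types or the text label. -/
inductive NodeLabel (L : Type*) where
  | elem (a : L) : NodeLabel L
  | str : NodeLabel L

/-- The language of words over node labels defined by a right-hand side. -/
def Content.lang {L : Type*} : Content L → Set (List (NodeLabel L))
  | .text => {[NodeLabel.str]}
  | .empty => {[]}
  | .seq l => {l.map NodeLabel.elem}
  | .alt l => {w | ∃ b ∈ l, w = [NodeLabel.elem b]}
  | .star b => {w | ∀ x ∈ w, x = NodeLabel.elem b}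

/-- Well-formed right-hand sides: the listed types are distinct, and concatenations and
disjunctions list at least one type. -/
def Content.WellFormed {L : Type*} : Content L → Prop
  | .text => True
  | .empty => True
  | .seq l => l ≠ [] ∧ l.Nodup
  | .alt l => l ≠ [] ∧ l.Nodup
  | .star _ => True

/-- Non-recursive structured DTDs over the label domain `L`.  The value of `rg` outside `ele`
is irrelevant. -/
structure DTD (L : Type*) where
  ele : Finset L
  rg : L → Content L
  root : L
  root_mem : root ∈ ele
  wellFormed : ∀ A ∈ ele, (rg A).WellFormed
  sub_mem : ∀ A ∈ ele, ∀ B ∈ (rg A).subs, B ∈ ele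
  nonrecursive : ∀ A, ¬ Relation.TransGen (fun X Y => X ∈ ele ∧ Y ∈ (rg X).subs) A A

/-- `D.Sub A B`: there is an edge from `A` to `B` in the DTD graph, i.e. `B` is a subelement type
of the element type `A`. -/
def DTD.Sub {L : Type*} (D : DTD L) (A B : L) : Prop := A ∈ D.ele ∧ B ∈ (D.rg A).subs

/-- `A ≤_D B`: the reflexive transitive closure of the subelement relation. -/
def DTD.Le {L : Type*} (D : DTD L) (A B : L) : Prop := Relation.ReflTransGen D.Sub A B

open Classical in
/-- The element types strictly below `A`. -/
noncomputable def DTD.strictlyBelow {L : Type*} (D : DTD L) (A : L) : Finset L :=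
  D.ele.filter fun C => Relation.TransGen D.Sub A C

theorem DTD.card_strictlyBelow_lt {L : Type*} {D : DTD L} {A B : L} (h : D.Sub A B) :
    (D.strictlyBelow B).card < (D.strictlyBelow A).card := by
  classical
  apply Finset.card_lt_card
  rw [Finset.ssubset_iff_of_subset]
  · exact ⟨B, by simp only [strictlyBelow, Finset.mem_filter]
                 exact ⟨D.sub_mem _ h.1 _ h.2, .single h⟩,
      fun hB => D.nonrecursive B (Finset.mem_filter.1 hB).2⟩
  · intro C hC
    simp only [strictlyBelow, Finset.mem_filter] at hC ⊢
    exact ⟨hC.1, Relation.TransGen.head h hC.2⟩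

/-! ### XML trees -/

/-- The data of an unordered XML tree.  Nodes are taken from `ℕ`; the values of `label` outside
`nodes`, and of `val` outside the nodes labelled `str`, are irrelevant. -/
structure XMLTree (L : Type*) where
  nodes : Finset ℕ
  /-- pairs (parent, child) -/
  edges : Finset (ℕ × ℕ)
  label : ℕ → NodeLabel L
  root : ℕ
  val : ℕ → String

namespace XMLTree

variable {L : Type*}

/-- The edge relation (parent, child). -/
def Edge (t : XMLTree L) (x y : ℕ) : Prop := (x, y) ∈ t.edges

/-- The data form a tree with the given root. -/
structure IsTree (t : XMLTree L) : Prop where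
  root_mem : t.root ∈ t.nodes
  edges_mem : ∀ x y, t.Edge x y → x ∈ t.nodes ∧ y ∈ t.nodes
  root_no_parent : ∀ x, ¬ t.Edge x t.root
  unique_parent : ∀ n ∈ t.nodes, n ≠ t.root → ∃! p, t.Edge p n
  reachable : ∀ n ∈ t.nodes, Relation.ReflTransGen t.Edge t.root n

/-- The children of a node. -/
def children (t : XMLTree L) (n : ℕ) : Finset ℕ := t.nodes.filter fun m => (n, m) ∈ t.edges

open Classical in
/-- The descendants of a node, the node itself included. -/
noncomputable def desc (t : XMLTree L) (n : ℕ) : Finset ℕ :=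
  t.nodes.filter fun m => Relation.ReflTransGen t.Edge n m

/-- `t` conforms to `D` at element type `A`; that is, `t ∈ I_D(A)`.  As trees are unordered, the
children of a node have to admit an ordering whose labels form a word of the language. -/
structure Conforms (D : DTD L) (A : L) (t : XMLTree L) : Prop where
  isTree : t.IsTree
  root_label : t.label t.root = .elem A
  labels : ∀ n ∈ t.nodes, t.label n = .str ∨ ∃ B ∈ D.ele, t.label n = .elem B
  content : ∀ n ∈ t.nodes, ∀ B, t.label n = .elem B →
    ∃ w ∈ (D.rg B).lang, (w : Multiset (NodeLabel L)) = (t.children n).val.map t.label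
  text_leaf : ∀ n ∈ t.nodes, t.label n = .str → t.children n = ∅

/-- Isomorphism of XML trees. -/
def Iso (t₁ t₂ : XMLTree L) : Prop :=
  ∃ h : ℕ → ℕ, Set.BijOn h t₁.nodes t₂.nodes ∧ h t₁.root = t₂.root ∧
    (∀ x ∈ t₁.nodes, ∀ y ∈ t₁.nodes, t₁.Edge x y ↔ t₂.Edge (h x) (h y)) ∧
    (∀ x ∈ t₁.nodes, t₁.label x = t₂.label (h x)) ∧
    (∀ x ∈ t₁.nodes, t₁.label x = .str → t₁.val x = t₂.val (h x))

end XMLTree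

/-! ### Atomic updates -/

/-- Atomic updates: `insert(n, u)`, `delete(n)`, `replace(n, u)` and `replace(n, s)`. -/
inductive Op (L : Type*) where
  | insert (n : ℕ) (u : XMLTree L) : Op L
  | delete (n : ℕ) : Op L
  | replace (n : ℕ) (u : XMLTree L) : Op L
  | replaceText (n : ℕ) (s : String) : Op L

namespace Op

variable {L : Type*}

/-- The result of applying an update to a tree.  When the subtree at `n` is removed, all edges that
touch it (also the edge from the parent of `n`) are removed. -/
noncomputable def apply : Op L → XMLTree L → XMLTree L
  | .insert n u, t =>
    { nodes := t.nodes ∪ u.nodes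
      edges := t.edges ∪ u.edges ∪ {(n, u.root)}
      label := fun m => if m ∈ u.nodes then u.label m else t.label m
      root := t.root
      val := fun m => if m ∈ u.nodes then u.val m else t.val m }
  | .delete n, t =>
    { nodes := t.nodes \ t.desc n
      edges := t.edges.filter fun e => e.1 ∉ t.desc n ∧ e.2 ∉ t.desc n
      label := t.label
      root := t.root
      val := t.val }
  | .replace n u, t =>
    { nodes := (t.nodes \ t.desc n) ∪ u.nodes
      edges := (t.edges.filter fun e => e.1 ∉ t.desc n ∧ e.2 ∉ t.desc n) ∪ u.edges ∪
        (t.nodes.filter fun p => (p, n) ∈ t.edges).image fun p => (p, u.root)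
      label := fun m => if m ∈ u.nodes then u.label m else t.label m
      root := t.root
      val := fun m => if m ∈ u.nodes then u.val m else t.val m }
  | .replaceText n s, t => { t with val := Function.update t.val n s }

/-- Validity of an update on a tree. -/
def Valid : Op L → XMLTree L → Prop
  | .insert n u, t => n ∈ t.nodes ∧ Disjoint t.nodes u.nodes
  | .delete n, t => n ∈ t.nodes
  | .replace n u, t => n ∈ t.nodes ∧ Disjoint t.nodes u.nodes
  | .replaceText n _, t => n ∈ t.nodes

end Op

/-! ### Update access types and policies -/

/-- Update access types `(A, insert(B))`, `(A, delete(B))`, `(A, replace(B, B'))` and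
`(A, replace(str, str))`. -/
inductive UAT (L : Type*) where
  | ins (A B : L) : UAT L
  | del (A B : L) : UAT L
  | repl (A B B' : L) : UAT L
  | replStr (A : L) : UAT L
  deriving DecidableEq

/-- The element type to which an update access type is attached. -/
def UAT.src {L : Type*} : UAT L → L
  | .ins A _ => A
  | .del A _ => A
  | .repl A _ _ => A
  | .replStr A => A

/-- `op` matches the update access type on `t`. -/
def Op.Matches {L : Type*} (D : DTD L) (t : XMLTree L) : Op L → UAT L → Prop
  | .insert n u, .ins A B => t.label n = .elem A ∧ XMLTree.Conforms D B u
  | .delete n, .del A B => t.label n = .elem B ∧ ∃ p, t.Edge p n ∧ t.label p = .elem A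
  | .replace n u, .repl A B B' => t.label n = .elem B ∧ XMLTree.Conforms D B' u ∧
      (∃ p, t.Edge p n ∧ t.label p = .elem A) ∧ B ≠ B'
  | .replaceText n _, .replStr A => t.label n = .str ∧ ∃ p, t.Edge p n ∧ t.label p = .elem A
  | _, _ => False

variable {L : Type*} [DecidableEq L]

/-- The valid update access types attached to `A`, by the form of the production rule of `A`. -/
def Content.validAt (A : L) : Content L → Finset (UAT L)
  | .text => {.replStr A}
  | .star B => {.ins A B, .del A B}
  | .alt l => ((l.toFinset ×ˢ l.toFinset).filter fun e => e.1 ≠ e.2).image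
      fun e => .repl A e.1 e.2
  | .seq _ => ∅
  | .empty => ∅

/-- The set `valid(D)` of update access types that are valid for `D`. -/
def DTD.valid (D : DTD L) : Finset (UAT L) := D.ele.biUnion fun A => (D.rg A).validAt A

/-- Security policies over `D`. -/
structure Policy (D : DTD L) where
  allowed : Finset (UAT L)
  forbidden : Finset (UAT L)
  allowed_subset : allowed ⊆ D.valid
  forbidden_subset : forbidden ⊆ D.valid
  disjoint : Disjoint allowed forbidden

/-- `op` is a valid update of `t` that matches some update access type in `S`. -/
def OpIn (D : DTD L) (S : Finset (UAT L)) (t : XMLTree L) (op : Op L) : Prop :=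
  op.Valid t ∧ ∃ u ∈ S, op.Matches D t u

/-- `Simulates D S t t'`: some sequence of updates that is allowed on `t` by `S` leads from `t`
to `t'`. -/
inductive Simulates (D : DTD L) (S : Finset (UAT L)) : XMLTree L → XMLTree L → Prop
  | nil (t : XMLTree L) : Simulates D S t t
  | cons (t t' : XMLTree L) (op : Op L) : OpIn D S t op → Simulates D S (op.apply t) t' →
      Simulates D S t t'

namespace Policy

variable {D : DTD L}

/-- A policy is total if every valid update access type is allowed or forbidden. -/
def IsTotal (P : Policy D) : Prop := P.allowed ∪ P.forbidden = D.valid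

/-- A policy that is not total is partial. -/
def IsPartial (P : Policy D) : Prop := ¬ P.IsTotal

/-- A policy is consistent if no forbidden update of an instance of `D` can be simulated by a
sequence of allowed updates.  Forbidden updates without any effect (replacing a text value by
itself) are disregarded: leaving the document as it is would simulate them. -/
def Consistent (P : Policy D) : Prop :=
  ∀ t : XMLTree L, t.Conforms D D.root → ∀ op₀ : Op L, OpIn D P.forbidden t op₀ →
    ¬ (op₀.apply t).Iso t → ∀ t' : XMLTree L, Simulates D P.allowed t t' →
      ¬ t'.Iso (op₀.apply t)

/-- The privilege ordering. -/
instance : LE (Policy D) := ⟨fun P Q => P.allowed ⊆ Q.allowed⟩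

/-- `P'` is a repair of `P`. -/
def IsRepairOf (P' P : Policy D) : Prop := P'.Consistent ∧ P' ≤ P

/-- `P'` is a total repair of `P`. -/
def IsTotalRepairOf (P' P : Policy D) : Prop :=
  P'.IsRepairOf P ∧ P'.forbidden = D.valid \ P'.allowed

/-- `P'` is a partial repair of `P`. -/
def IsPartialRepairOf (P' P : Policy D) : Prop :=
  P'.IsRepairOf P ∧ P'.forbidden ≠ D.valid \ P'.allowed

end Policy

/-! ### Traversing the DTD graph -/

/-- The successors of a node in the DTD graph. -/
def DTD.children (D : DTD L) (A : L) : List L := if A ∈ D.ele then (D.rg A).subs else []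

theorem DTD.mem_children {D : DTD L} {A B : L} : B ∈ D.children A ↔ D.Sub A B := by
  unfold DTD.children DTD.Sub
  split <;> simp_all

/-! ### The marked DTD graph -/

/-- `Marked P A` says that the node `A` gets the mark `-`: either some update access type attached
to `A` is forbidden, or some successor of `A` is marked `-`.  The other nodes are marked `+`. -/
def Marked {D : DTD L} (P : Policy D) (A : L) : Prop :=
  (∃ u ∈ P.forbidden, u.src = A) ∨ ∃ B : {B // B ∈ D.children A}, Marked P B.1
termination_by (D.strictlyBelow A).card
decreasing_by exact DTD.card_strictlyBelow_lt (DTD.mem_children.1 B.2)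

/-- A node is marked `-` exactly if something is forbidden below it. -/
theorem marked_iff {D : DTD L} (P : Policy D) (A : L) :
    Marked P A ↔ ∃ C, D.Le A C ∧ ∃ u ∈ P.forbidden, u.src = C := by
  constructor
  · intro h
    induction hn : (D.strictlyBelow A).card using Nat.strong_induction_on generalizing A with
    | _ n ih =>
      rw [Marked] at h
      rcases h with h | ⟨⟨B, hB⟩, h⟩
      · exact ⟨A, .refl, h⟩
      · have hs := DTD.mem_children.1 hB
        obtain ⟨C, hC, hu⟩ := ih _ (hn ▸ DTD.card_strictlyBelow_lt hs) B h rfl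
        exact ⟨C, Relation.ReflTransGen.head hs hC, hu⟩
  · rintro ⟨C, hC, hu⟩
    induction hC using Relation.ReflTransGen.head_induction_on with
    | refl => rw [Marked]; exact .inl hu
    | head h _ ih => rw [Marked]; exact .inr ⟨⟨_, DTD.mem_children.2 h⟩, ih⟩

/-- `Flagged P A` says that the node `A` gets the label `⊥`. -/
def Flagged {D : DTD L} (P : Policy D) (A : L) : Prop :=
  Marked P A ∧ ∃ B ∈ D.children A, UAT.ins A B ∈ P.allowed ∧ UAT.del A B ∈ P.allowed

/-! ### Repairing insert/delete-inconsistencies -/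

open Classical in
/-- Algorithm InsDelRepair.  `pick A` is the random choice between `(A, insert(B))` and
`(A, delete(B))`. -/
noncomputable def insDelRepair {D : DTD L} (P : Policy D) (pick : L → Bool) : Finset (UAT L) :=
  D.ele.biUnion fun A => (D.children A).toFinset.biUnion fun B =>
    if Flagged P A then {if pick A then .ins A B else .del A B} else ∅

/-! ### Repairing replace-inconsistencies: the naive algorithm -/

/-- The edges of the replace graph of `A`, whose vertices are the members of `V`. -/
def replaceEdges {D : DTD L} (P : Policy D) (A : L) (V : List L) : Finset (L × L) :=
  (V.toFinset ×ˢ V.toFinset).filter fun e => UAT.repl A e.1 e.2 ∈ P.allowed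

/-- The forbidden edges of `A`. -/
def forbiddenEdges {D : DTD L} (P : Policy D) (A : L) (V : List L) : Finset (L × L) :=
  (V.toFinset ×ˢ V.toFinset).filter fun e => UAT.repl A e.1 e.2 ∈ P.forbidden

open Classical in
/-- The body of the two inner loops of the naive algorithm, for the vertex `B` that was popped from
the stack and the pair `(A, Z)`.  The state is the stack with the set of deleted edges.  If the
present edges `(A, B)`, `(B, Z)` violate transitivity, or form a cycle through a vertex marked `-`,
then one of them is deleted (`pick` is the random choice), and all vertices that are reachable
from its source are pushed on the stack. -/
noncomputable def naiveStep (V : List L) (G : Finset (L × L)) (neg : L → Prop)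
    (pick : Finset (L × L) → L → L → L → Bool) (B : L) (s : List L × Finset (L × L))
    (p : L × L) : List L × Finset (L × L) :=
  if ((p.1, B) ∈ G \ s.2 ∧ (B, p.2) ∈ G \ s.2) ∧
      ((p.1 ≠ p.2 ∧ p ∉ G \ s.2) ∨ (p.1 = p.2 ∧ neg p.1)) then
    let e := if pick s.2 p.1 B p.2 then (p.1, B) else (B, p.2)
    ((V.filter fun F => Relation.ReflTransGen (fun x y => (x, y) ∈ G) e.1 F) ++ s.1, insert e s.2)
  else s

/-- The two inner loops of the naive algorithm, run after `B` was popped. -/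
noncomputable def naiveScan (V : List L) (G : Finset (L × L)) (neg : L → Prop)
    (pick : Finset (L × L) → L → L → L → Bool) (B : L) (s : List L × Finset (L × L)) :
    List L × Finset (L × L) :=
  (V.product V).foldl (naiveStep V G neg pick B) s

theorem naiveStep_eq_or {V : List L} {G : Finset (L × L)} {neg : L → Prop}
    {pick : Finset (L × L) → L → L → L → Bool} {B : L} (s : List L × Finset (L × L)) (p : L × L) :
    naiveStep V G neg pick B s p = s ∨
      (G \ (naiveStep V G neg pick B s p).2).card < (G \ s.2).card := by
  unfold naiveStep
  split
  case isFalse => exact .inl rfl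
  case isTrue h =>
    right
    have key : ∀ e ∈ G \ s.2, (G \ insert e s.2).card < (G \ s.2).card := by
      intro e he
      rw [Finset.sdiff_insert]
      exact Finset.card_erase_lt_of_mem he
    simp only
    split
    · exact key _ h.1.1
    · exact key _ h.1.2

theorem naiveScan_eq_or {V : List L} {G : Finset (L × L)} {neg : L → Prop}
    {pick : Finset (L × L) → L → L → L → Bool} {B : L} (s : List L × Finset (L × L)) :
    naiveScan V G neg pick B s = s ∨
      (G \ (naiveScan V G neg pick B s).2).card < (G \ s.2).card := by
  unfold naiveScan
  induction V.product V generalizing s with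
  | nil => exact .inl rfl
  | cons p l ih =>
    rw [List.foldl_cons]
    rcases naiveStep_eq_or (V := V) (G := G) (neg := neg) (pick := pick) (B := B) s p with h | h
    · rw [h]; exact ih s
    · rcases ih (naiveStep V G neg pick B s p) with h' | h'
      · rw [h']; exact .inr h
      · exact .inr (h'.trans h)

/-- The while loop of the naive algorithm, with the current stack and the set of edges deleted so
far; it returns the set of deleted edges. -/
noncomputable def naiveLoop (V : List L) (G : Finset (L × L)) (neg : L → Prop)
    (pick : Finset (L × L) → L → L → L → Bool) (stack : List L) (C : Finset (L × L)) :
    Finset (L × L) :=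
  match stack with
  | [] => C
  | B :: S =>
    naiveLoop V G neg pick (naiveScan V G neg pick B (S, C)).1
      (naiveScan V G neg pick B (S, C)).2
termination_by ((G \ C).card, stack.length)
decreasing_by
  rcases naiveScan_eq_or (V := V) (G := G) (neg := neg) (pick := pick) (B := B) (S, C) with h | h
  · rw [h]; exact Prod.Lex.right _ (by simp)
  · exact Prod.Lex.left _ _ h

/-! ### Repairing replace-inconsistencies: the set cover algorithm -/

/-- Algorithms for set cover.  An instance is given by a universe `U` of sets of edges and a set `E`
of edges; the edge `e` covers those members of `U` that contain it.  Whenever a cover exists the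
algorithm returns one (as a set of edges of `E`), not necessarily a minimum one, and it never
selects an edge that covers nothing. -/
structure SetCoverAlg (ε : Type*) where
  run : Finset ε → Finset (Finset ε) → Finset ε
  run_subset : ∀ E U, run E U ⊆ E
  covers : ∀ E U, (∀ s ∈ U, ∃ e ∈ E, e ∈ s) → ∀ s ∈ U, ∃ e ∈ run E U, e ∈ s
  useful : ∀ E U, ∀ e ∈ run E U, ∃ s ∈ U, e ∈ s

open Classical in
/-- The greedy algorithm: as long as some member of `U` can be covered, select an edge that covers
as many members as possible. -/
noncomputable def greedyCover {ε : Type*} (E : Finset ε) (U : Finset (Finset ε)) : Finset ε :=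
  if h : ∃ e ∈ E, (U.filter fun s => e ∈ s).Nonempty then
    let e := (Finset.exists_max_image E (fun e => (U.filter fun s => e ∈ s).card)
      (h.imp fun _ he => he.1)).choose
    insert e (greedyCover E (U.filter fun s => e ∉ s))
  else ∅
termination_by U.card
decreasing_by
  obtain ⟨h₁, h₂⟩ := (Finset.exists_max_image E (fun e => (U.filter fun s => e ∈ s).card)
    (h.imp fun _ he => he.1)).choose_spec
  obtain ⟨e', he', hne⟩ := h
  have hpos := lt_of_lt_of_le (Finset.card_pos.2 hne) (h₂ e' he')
  obtain ⟨s, hs⟩ := Finset.card_pos.1 hpos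
  rw [Finset.mem_filter] at hs
  refine Finset.card_lt_card (Finset.filter_ssubset.2 ⟨s, hs.1, ?_⟩)
  exact not_not.2 hs.2

theorem greedyCover_spec {ε : Type*} (E : Finset ε) (U : Finset (Finset ε)) :
    greedyCover E U ⊆ E ∧ (∀ s ∈ U, (∃ e ∈ E, e ∈ s) → ∃ e ∈ greedyCover E U, e ∈ s) ∧
      ∀ e ∈ greedyCover E U, ∃ s ∈ U, e ∈ s := by
  classical
  induction hn : U.card using Nat.strong_induction_on generalizing U with
  | _ n ih =>
    rw [greedyCover]
    split
    case isFalse h =>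
      refine ⟨Finset.empty_subset _, ?_, by simp⟩
      rintro s hs ⟨e, he, hes⟩
      exact absurd ⟨e, he, s, Finset.mem_filter.2 ⟨hs, hes⟩⟩ h
    case isTrue h =>
      have hsp := (Finset.exists_max_image E (fun e => (U.filter fun s => e ∈ s).card)
        (h.imp fun _ he => he.1)).choose_spec
      set e := (Finset.exists_max_image E (fun e => (U.filter fun s => e ∈ s).card)
        (h.imp fun _ he => he.1)).choose with hedef
      obtain ⟨h₁, h₂⟩ := hsp
      obtain ⟨e', he', hne⟩ := h
      have hpos := lt_of_lt_of_le (Finset.card_pos.2 hne) (h₂ e' he')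
      obtain ⟨s₀, hs₀⟩ := Finset.card_pos.1 hpos
      rw [Finset.mem_filter] at hs₀
      have hlt : (U.filter fun s => e ∉ s).card < U.card :=
        Finset.card_lt_card (Finset.filter_ssubset.2 ⟨s₀, hs₀.1, not_not.2 hs₀.2⟩)
      obtain ⟨i₁, i₂, i₃⟩ := ih _ (hn ▸ hlt) _ rfl
      refine ⟨Finset.insert_subset h₁ i₁, ?_, ?_⟩
      · intro s hs hE
        by_cases hes : e ∈ s
        · exact ⟨e, Finset.mem_insert_self _ _, hes⟩
        · obtain ⟨x, hx, hxs⟩ := i₂ s (Finset.mem_filter.2 ⟨hs, hes⟩) hE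
          exact ⟨x, Finset.mem_insert_of_mem hx, hxs⟩
      · intro x hx
        rcases Finset.mem_insert.1 hx with rfl | hx
        · exact ⟨s₀, hs₀.1, hs₀.2⟩
        · obtain ⟨s, hs, hxs⟩ := i₃ x hx
          exact ⟨s, (Finset.mem_filter.1 hs).1, hxs⟩

/-- The greedy algorithm is a set cover algorithm. -/
noncomputable def SetCoverAlg.greedy (ε : Type*) : SetCoverAlg ε where
  run := greedyCover
  run_subset E U := (greedyCover_spec E U).1
  covers E U h s hs := (greedyCover_spec E U).2.1 s hs (h s hs)
  useful E U := (greedyCover_spec E U).2.2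

/-- The state of the computation of justifications: the set of edges constructed so far (they are
added to the replace graph), and the lists of justifications of the edges and of the vertices. -/
structure JState (L : Type*) where
  derived : Finset (L × L)
  edgeJ : L × L → List (Finset (L × L))
  vertJ : L → List (Finset (L × L))

/-- Add the union of each justification in `J₁` with each one in `J₂` to `J`, as long as `J` has
fewer than `mnj` members. -/
def addJustifications (mnj : ℕ) (J₁ J₂ J : List (Finset (L × L))) : List (Finset (L × L)) :=
  (J₁.product J₂).foldl (fun J p => if J.length < mnj then J.insert (p.1 ∪ p.2) else J) J

open Classical in
/-- The body of the loops of the modified Floyd-Warshall algorithm, for the intermediate vertex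
`B = q.1`, the start `A = q.2.1` and the end `Z = q.2.2`. -/
noncomputable def justStep (mnj : ℕ) (G : Finset (L × L)) (neg : L → Prop) (s : JState L)
    (q : L × L × L) : JState L :=
  let B := q.1
  let A := q.2.1
  let Z := q.2.2
  if (A, B) ∈ G ∪ s.derived ∧ (B, Z) ∈ G ∪ s.derived then
    if A ≠ Z ∧ (A, Z) ∉ G then
      { s with
        derived := insert (A, Z) s.derived
        edgeJ := Function.update s.edgeJ (A, Z)
          (addJustifications mnj (s.edgeJ (A, B)) (s.edgeJ (B, Z)) (s.edgeJ (A, Z))) }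
    else if A = Z ∧ neg A then
      { s with
        vertJ := Function.update s.vertJ A
          (addJustifications mnj (s.edgeJ (A, B)) (s.edgeJ (B, A)) (s.vertJ A)) }
    else s
  else s

/-- Algorithm ComputeJustifications: a run of the Floyd-Warshall algorithm on the replace graph
with vertices `V` and edges `G` (the loop over the intermediate vertex is the outermost one). -/
noncomputable def computeJustifications (mnj : ℕ) (V : List L) (G : Finset (L × L))
    (neg : L → Prop) : JState L :=
  (V.product (V.product V)).foldl (justStep mnj G neg)
    { derived := ∅
      edgeJ := fun e => if e ∈ G then [{e}] else []
      vertJ := fun _ => [] }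

/-- The universe of the set cover instance: all justifications of forbidden edges and of
vertices. -/
def coverUniverse (V : List L) (F : Finset (L × L)) (s : JState L) : Finset (Finset (L × L)) :=
  (F.biUnion fun e => (s.edgeJ e).toFinset) ∪ V.toFinset.biUnion fun v => (s.vertJ v).toFinset

/-- The while loop of the set cover algorithm, with the current replace graph `G` and the set `C` of
edges deleted so far; deleted edges are forbidden from then on.  It returns the set of deleted
edges. -/
noncomputable def setCoverLoop (sc : SetCoverAlg (L × L)) (mnj : ℕ) (V : List L)
    (F : Finset (L × L)) (neg : L → Prop) (G C : Finset (L × L)) : Finset (L × L) :=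
  let sce := sc.run G (coverUniverse V (F ∪ C) (computeJustifications mnj V G neg))
  if sce = ∅ then C else setCoverLoop sc mnj V F neg (G \ sce) (C ∪ sce)
termination_by G.card
decreasing_by
  rename_i h
  refine Finset.card_lt_card (Finset.sdiff_ssubset (sc.run_subset _ _) ?_)
  exact Finset.nonempty_iff_ne_empty.2 h

/-! ### The repair algorithm -/

/-- The recursive traversal of the DTD graph from the node `R`: apply `own` to `R` and then traverse
from every successor of `R`.  A node is visited once for every path that leads to it; `path` records
the nodes passed through before `R`. -/
def traverse {D : DTD L} (own : List L → L → Finset (L × Finset (L × L))) (path : List L) (R : L) :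
    Finset (L × Finset (L × L)) :=
  own path R ∪ (D.children R).attach.toFinset.biUnion fun B => traverse (D := D) own (R :: path) B.1
termination_by (D.strictlyBelow R).card
decreasing_by exact DTD.card_strictlyBelow_lt (DTD.mem_children.1 B.2)

/-- Algorithm ReplaceNaive, started at the root.  `pick` is the source of random choices; they may
depend on the visit of the node, on the edges deleted so far and on the edges under
consideration. -/
noncomputable def replaceNaive {D : DTD L} (P : Policy D)
    (pick : List L → L → Finset (L × L) → L → L → L → Bool) : Finset (L × Finset (L × L)) :=
  traverse (D := D) (fun path R =>
    match D.rg R with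
    | .alt V => {(R, naiveLoop V (replaceEdges P R V) (Marked P) (pick path R) V ∅)}
    | _ => ∅) [] D.root

/-- Algorithm ReplaceSetCover, started at the root, with at most `mnj` justifications for every edge
and vertex. -/
noncomputable def replaceSetCover {D : DTD L} (P : Policy D) (sc : SetCoverAlg (L × L)) (mnj : ℕ) :
    Finset (L × Finset (L × L)) :=
  traverse (D := D) (fun _ R =>
    match D.rg R with
    | .alt V => {(R, setCoverLoop sc mnj V (forbiddenEdges P R V) (Marked P)
        (replaceEdges P R V) ∅)}
    | _ => ∅) [] D.root

/-- The unspecified ingredients of a run of the repair algorithm: the random choices of InsDelRepair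
and of ReplaceNaive, and the set cover algorithm that is used. -/
structure Choices (L : Type*) where
  insDel : L → Bool
  naive : List L → L → Finset (L × L) → L → L → L → Bool
  setCover : SetCoverAlg (L × L)

/-- Algorithm ReplaceRepair. -/
noncomputable def replaceRepair {D : DTD L} (P : Policy D) (mnj : ℕ) (ch : Choices L) :
    Finset (UAT L) :=
  (if mnj = 0 then replaceNaive P ch.naive else replaceSetCover P ch.setCover mnj).biUnion
    fun s => s.2.image fun e => UAT.repl s.1 e.1 e.2

/-- The update access types that the repair algorithm removes. -/
noncomputable def changes {D : DTD L} (P : Policy D) (mnj : ℕ) (ch : Choices L) :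
    Finset (UAT L) :=
  insDelRepair P ch.insDel ∪ replaceRepair P mnj ch

/-- Algorithm Repair. -/
noncomputable def repair {D : DTD L} (P : Policy D) (mnj : ℕ) (ch : Choices L) (total : Bool) :
    Policy D where
  allowed := P.allowed \ changes P mnj ch
  forbidden := if total then D.valid \ (P.allowed \ changes P mnj ch) else P.forbidden
  allowed_subset := Finset.sdiff_subset.trans P.allowed_subset
  forbidden_subset := by
    split
    · exact Finset.sdiff_subset
    · exact P.forbidden_subset
  disjoint := by
    split
    · exact Finset.disjoint_sdiff
    · exact Finset.disjoint_of_subset_left Finset.sdiff_subset P.disjoint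

end XMLRepair

/-!
The repaired policy is consistent because it satisfies, at each production rule, a local condition
that rules out every simulation of a forbidden update. Call an element type marked if something is
forbidden at or below it. The local conditions (`LocallyConsistent`) say that

* a marked type `A → B*` does not have both insertion and deletion allowed, and
* at a disjunction that is reachable from the root, no forbidden replacement lies in the transitive
  closure of the allowed ones, and no marked type lies on a cycle of allowed ones.

*The local conditions imply consistency.* Isomorphic trees are identified by coding a tree as the
pair of its root and the multiset of the codes of its immediate subtrees (`UTree.node`). On codes an
update is a relation `Step`, and `LocallyConsistent.not_reach` shows by induction on a forbidden
step from `x` to `y` that allowed steps cannot lead from `x` to `y`. If the forbidden update happens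
at the root of `x`, then it changes the number of subtrees in a direction that is not allowed, or it
is a forbidden replacement, or it changes the only string. If it happens in a subtree, then the
subtree is of a marked type. At a disjunction the simulation cannot leave and return to this type,
so it takes place in the subtree. At a star it can neither insert nor delete, since the number of
subtrees is the same before and after, and only one of the two directions is allowed; so it matches
the multiset `x' ::ₘ m` of subtrees with `y' ::ₘ m`. The matching is a permutation which may move
unchanged subtrees, but following the cycle through `x'` gives a simulation from `x'` to `y'`
(`rel_of_rel_cons_cons`), and the induction hypothesis applies. Concatenations are treated in the
same way. That updates of XML trees preserve conformance and act on codes as steps is `OpIn.step`; a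
replacement is a deletion followed by an insertion at the parent.

*The algorithm establishes the local conditions.* InsDelRepair takes care of the first one. In the
naive algorithm, violations of transitivity are found only at vertices on the stack (`ScanInv`), so
there are none at the end (`naiveLoop_spec`), and a transitive set of allowed edges contains no
forbidden edge in its closure. In the set cover algorithm, the Floyd-Warshall algorithm closes the
replace graph under composition off the diagonal and finds the marked vertices on cycles
(`computeJustifications_spec`). As every edge that it finds has a justification, the loop can only
stop when no forbidden edge and no marked cycle is left (`setCoverLoop_spec`). A type may be
visited several times with different sets of deleted edges, but what remains in the end is contained
in what remains after each single visit, and this suffices for both conditions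
(`locallyConsistent_sdiff_changes`).

For a total repair the removed update access types become forbidden, which might create new marks.
It does not, since a total policy that forbids nothing at or below a disjunction allows all
replacements there, and then nothing is removed (`marked_of_mem_changes`).
-/

namespace XMLRepair

/-! ### Codes of unordered trees -/

section Codes

universe u

/-- Codes of finite unordered labelled trees.  Any infinite type at least as large as `L` has room
for them: see `UTree.node`. -/
def UTree (L : Type u) : Type u := L ⊕ ℕ

variable {L : Type u}

instance : Infinite (UTree L) := inferInstanceAs (Infinite (L ⊕ ℕ))

instance : Nonempty (UTree L) := inferInstance

/-- The multisets over an infinite type are as many as its elements, so the codes exist by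
cardinality. -/
theorem UTree.exists_node (L : Type u) :
    Nonempty ((L ⊕ String) × Multiset (UTree L) ↪ UTree L) := by
  rw [← Cardinal.le_def]
  have hS : Cardinal.mk String ≤ Cardinal.aleph0 := Cardinal.mk_le_aleph0_iff.2
    (Function.Injective.countable (f := fun s => s.toList.map Char.toNat) fun s s' h =>
      String.toList_inj.1 (List.map_injective_iff.2 (fun c c' h => Char.toNat_inj.1 h) h))
  have hX : Cardinal.aleph0 ≤ Cardinal.mk (UTree L) := Cardinal.aleph0_le_mk _
  have hL : Cardinal.mk L ≤ Cardinal.mk (UTree L) :=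
    Cardinal.mk_le_of_injective (f := (Sum.inl : L → L ⊕ ℕ)) Sum.inl_injective
  have hM : Cardinal.mk (Multiset (UTree L)) = Cardinal.mk (UTree L) :=
    Cardinal.mk_multiset_of_infinite _
  have hK : Cardinal.mk (L ⊕ String) ≤ Cardinal.mk (UTree L) := by
    rw [Cardinal.mk_sum]
    refine Cardinal.add_le_of_le hX (by simpa using hL) ?_
    exact (Cardinal.lift_le.2 hS).trans (by simp)
  rw [Cardinal.mk_prod, Cardinal.lift_id, Cardinal.lift_id, hM]
  exact Cardinal.mul_le_of_le hX hK le_rfl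

/-- The code of a tree from its root, an element type or a string, and from the codes of its
immediate subtrees.  Injectivity is all that is needed: isomorphic trees get the same code, and a
code determines the root and the multiset of immediate subtrees. -/
noncomputable def UTree.node : (L ⊕ String) × Multiset (UTree L) ↪ UTree L :=
  (UTree.exists_node L).some

/-- The tree whose root is an `A`-node with the given immediate subtrees. -/
noncomputable def UTree.elem (A : L) (m : Multiset (UTree L)) : UTree L := node (.inl A, m)

/-- The tree that consists of one text node. -/
noncomputable def UTree.text (s : String) : UTree L := node (.inr s, 0)

theorem UTree.elem_inj {A B : L} {m n : Multiset (UTree L)} :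
    elem A m = elem B n ↔ A = B ∧ m = n := by
  simp [elem]

theorem UTree.text_inj {s s' : String} : (text s : UTree L) = text s' ↔ s = s' := by
  simp [text]

theorem UTree.elem_ne_text {A : L} {m : Multiset (UTree L)} {s : String} :
    elem A m ≠ text s := by
  simp [elem, text]

/-- The label of the root (an arbitrary one if `x` is not the code of a tree). -/
noncomputable def UTree.label (x : UTree L) : NodeLabel L :=
  match (Function.invFun node x : (L ⊕ String) × Multiset (UTree L)).1 with
  | .inl a => .elem a
  | .inr _ => .str

@[simp] theorem UTree.label_elem (A : L) (m : Multiset (UTree L)) :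
    (elem A m).label = .elem A := by
  simp [label, elem, Function.leftInverse_invFun node.injective _]

@[simp] theorem UTree.label_text (s : String) : (text s : UTree L).label = .str := by
  simp [label, text, Function.leftInverse_invFun node.injective _]

open UTree

/-- Codes of the instances of a DTD (at any element type, or text nodes). -/
inductive Inst (D : DTD L) : UTree L → Prop
  | text (s : String) : Inst D (text s)
  | elem (A : L) (m : Multiset (UTree L)) : A ∈ D.ele →
      (∃ w ∈ (D.rg A).lang, (w : Multiset (NodeLabel L)) = m.map label) →
      (∀ x ∈ m, Inst D x) → Inst D (elem A m)

theorem Inst.elem_inv {D : DTD L} {A : L} {m : Multiset (UTree L)} (h : Inst D (UTree.elem A m)) :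
    A ∈ D.ele ∧ (∃ w ∈ (D.rg A).lang, (w : Multiset (NodeLabel L)) = m.map label) ∧
      ∀ x ∈ m, Inst D x := by
  generalize hx : UTree.elem A m = x at h
  cases h with
  | text s => exact absurd hx elem_ne_text
  | elem B n h1 h2 h3 =>
    obtain ⟨rfl, rfl⟩ := elem_inj.1 hx
    exact ⟨h1, h2, h3⟩

/-- The effect at its root `A` of one update in `S` on the multiset of immediate subtrees; `R` is
the effect of an update in a subtree. -/
inductive StepAt (S : Finset (UAT L)) (R : UTree L → UTree L → Prop) (A : L) :
    Multiset (UTree L) → Multiset (UTree L) → Prop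
  | child (x y : UTree L) (m : Multiset (UTree L)) : R x y → StepAt S R A (x ::ₘ m) (y ::ₘ m)
  | ins (B : L) (y : UTree L) (m : Multiset (UTree L)) : .ins A B ∈ S → StepAt S R A m (y ::ₘ m)
  | del (B : L) (y : UTree L) (m : Multiset (UTree L)) : .del A B ∈ S → StepAt S R A (y ::ₘ m) m
  | repl (x y : UTree L) (m : Multiset (UTree L)) (B B' : L) : x.label = .elem B →
      y.label = .elem B' → .repl A B B' ∈ S → StepAt S R A (x ::ₘ m) (y ::ₘ m)
  | text (s s' : String) (m : Multiset (UTree L)) : .replStr A ∈ S → s ≠ s' →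
      StepAt S R A (text s ::ₘ m) (text s' ::ₘ m)

theorem StepAt.mono {S : Finset (UAT L)} {R R' : UTree L → UTree L → Prop} {A : L}
    {m n : Multiset (UTree L)} (h : StepAt S R A m n)
    (hR : ∀ x ∈ m, ∀ y ∈ n, R x y → R' x y) : StepAt S R' A m n := by
  cases h with
  | child x y _ h =>
    exact .child x y _ (hR _ (Multiset.mem_cons_self _ _) _ (Multiset.mem_cons_self _ _) h)
  | ins B y _ h => exact .ins B y _ h
  | del B y _ h => exact .del B y _ h
  | repl x y _ B B' h1 h2 h3 => exact .repl x y _ B B' h1 h2 h3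
  | text s s' _ h1 h2 => exact .text s s' _ h1 h2

/-- The effect on codes of one update, somewhere in the tree, that matches a member of `S` and that
does not replace a string by itself. -/
inductive Step (S : Finset (UAT L)) : UTree L → UTree L → Prop
  | child (A : L) (x y : UTree L) (m : Multiset (UTree L)) : Step S x y →
      Step S (elem A (x ::ₘ m)) (elem A (y ::ₘ m))
  | here (A : L) (m n : Multiset (UTree L)) : StepAt S (fun _ _ => False) A m n →
      Step S (elem A m) (elem A n)

theorem Step.inv {S : Finset (UAT L)} {A : L} {m : Multiset (UTree L)} {z : UTree L}
    (h : Step S (elem A m) z) : ∃ n, z = elem A n ∧ StepAt S (Step S) A m n := by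
  generalize hx : elem A m = x at h
  cases h with
  | child B x y n h =>
    obtain ⟨rfl, rfl⟩ := elem_inj.1 hx
    exact ⟨_, rfl, .child _ _ _ h⟩
  | here B n n' h =>
    obtain ⟨rfl, rfl⟩ := elem_inj.1 hx
    refine ⟨_, rfl, ?_⟩
    exact StepAt.mono h fun _ _ _ _ h => h.elim

theorem Step.label_eq {S : Finset (UAT L)} {x y : UTree L} (h : Step S x y) :
    ∃ A, x.label = .elem A ∧ y.label = .elem A := by
  cases h <;> exact ⟨_, label_elem _ _, label_elem _ _⟩

/-- Updates in `S` that lead from instances to instances. -/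
def InstStep (D : DTD L) (S : Finset (UAT L)) (x y : UTree L) : Prop :=
  Inst D x ∧ Inst D y ∧ Step S x y

/-- Simulation on codes. -/
abbrev Reach (D : DTD L) (S : Finset (UAT L)) : UTree L → UTree L → Prop :=
  Relation.ReflTransGen (InstStep D S)

theorem Reach.label_eq {D : DTD L} {S : Finset (UAT L)} {x y : UTree L} (h : Reach D S x y) :
    x.label = y.label := by
  induction h with
  | refl => rfl
  | tail _ h ih =>
    obtain ⟨A, h1, h2⟩ := h.2.2.label_eq
    rw [ih, h1, h2]

theorem Reach.text_eq {D : DTD L} {S : Finset (UAT L)} {s : String} {y : UTree L}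
    (h : Reach D S (text s) y) : y = text s := by
  induction h with
  | refl => rfl
  | tail _ h ih =>
    subst ih
    obtain ⟨A, h1, -⟩ := h.2.2.label_eq
    simp at h1

/-- A property of the multiset of immediate subtrees that every update preserves is preserved by
simulations. -/
theorem Reach.elem_induction {D : DTD L} {S : Finset (UAT L)} {A : L} {m : Multiset (UTree L)}
    {z : UTree L} (h : Reach D S (elem A m) z) (Q : Multiset (UTree L) → Prop) (h0 : Q m)
    (hstep : ∀ m₁ m₂, Q m₁ → Inst D (elem A m₁) → Inst D (elem A m₂) →
      StepAt S (InstStep D S) A m₁ m₂ → Q m₂) : ∃ n, z = elem A n ∧ Q n := by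
  induction h with
  | refl => exact ⟨m, rfl, h0⟩
  | tail _ h ih =>
    obtain ⟨n, rfl, hn⟩ := ih
    obtain ⟨i1, i2, h⟩ := h
    obtain ⟨n', rfl, hs⟩ := h.inv
    refine ⟨n', rfl, hstep n n' hn i1 i2 ?_⟩
    exact hs.mono fun _ hx _ hy h => ⟨i1.elem_inv.2.2 _ hx, i2.elem_inv.2.2 _ hy, h⟩

theorem rel_tail {α : Type*} {r : α → α → Prop} {m n : Multiset α} {x y : α}
    (h : Multiset.Rel (Relation.ReflTransGen r) m (x ::ₘ n)) (hxy : r x y) :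
    Multiset.Rel (Relation.ReflTransGen r) m (y ::ₘ n) :=
  h.trans _ (.cons (.single hxy) (Multiset.rel_refl_of_refl_on fun _ _ => .refl))

/-- If `x ::ₘ m` and `y ::ₘ m` are matched along a reflexive and transitive relation, then `x` is
related to `y`: follow the cycle of the matching, read as a permutation of `m` with `x` and `y`
identified, that passes through `x`. -/
theorem rel_of_rel_cons_cons {α : Type*} {r : α → α → Prop} {m : Multiset α} {x y : α}
    (h : Multiset.Rel (Relation.ReflTransGen r) (x ::ₘ m) (y ::ₘ m)) :
    Relation.ReflTransGen r x y := by
  classical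
  induction hn : Multiset.card m generalizing m x with
  | zero =>
    rw [Multiset.card_eq_zero] at hn
    subst hn
    obtain ⟨b, bs, hb, -, he⟩ := Multiset.rel_cons_left.1 h
    obtain ⟨rfl, -⟩ : y = b ∧ 0 = bs := by
      have := congrArg Multiset.card he
      have h0 : bs = 0 := by simpa using this
      subst h0
      simpa using he
    exact hb
  | succ k ih =>
    obtain ⟨b, bs, hb, hr, he⟩ := Multiset.rel_cons_left.1 h
    rcases Multiset.cons_eq_cons.1 he with ⟨rfl, rfl⟩ | ⟨hne, m', hm, hbs⟩
    · exact hb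
    · subst hm hbs
      exact hb.trans (ih hr (by simpa using hn))

theorem Content.mem_subs_of_mem_lang {c : Content L} {w : List (NodeLabel L)}
    (hw : w ∈ c.lang) {B : L} (hB : NodeLabel.elem B ∈ w) : B ∈ c.subs := by
  cases c <;> simp only [Content.lang, Set.mem_singleton_iff, Set.mem_ofPred_eq] at hw
  · simp [hw] at hB
  · simp [hw] at hB
  · simpa [hw, Content.subs] using hB
  · obtain ⟨b, hb, rfl⟩ := hw
    simp only [List.mem_singleton, NodeLabel.elem.injEq] at hB
    simpa [Content.subs, hB] using hb
  · simpa [Content.subs] using hw _ hB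

theorem DTD.Le.mem_ele {D : DTD L} {A B : L} (h : D.Le A B) (hA : A ∈ D.ele) : B ∈ D.ele := by
  induction h with
  | refl => exact hA
  | tail _ h _ => exact D.sub_mem _ h.1 _ h.2

/-- The element types of the immediate subtrees are successors of the root in the DTD graph. -/
theorem Inst.sub {D : DTD L} {A B : L} {m : Multiset (UTree L)} {x : UTree L}
    (h : Inst D (UTree.elem A m)) (hx : x ∈ m) (hB : x.label = .elem B) : D.Sub A B := by
  obtain ⟨hA, ⟨w, hw, he⟩, -⟩ := h.elem_inv
  refine ⟨hA, ?_⟩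
  have hm : NodeLabel.elem B ∈ w := by
    rw [← Multiset.mem_coe, he, Multiset.mem_map]
    exact ⟨x, hx, hB⟩
  exact Content.mem_subs_of_mem_lang hw hm

/-- Where nothing at all is allowed at the root, a simulation acts on each immediate subtree
separately. -/
theorem Reach.rel {D : DTD L} {S : Finset (UAT L)} {A : L}
    (hS : ∀ u ∈ S, u.src ≠ A) {m : Multiset (UTree L)}
    {z : UTree L} (h : Reach D S (elem A m) z) :
    ∃ n, z = elem A n ∧ Multiset.Rel (Reach D S) m n := by
  refine h.elem_induction _ (Multiset.rel_refl_of_refl_on fun _ _ => .refl) ?_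
  intro m₁ m₂ hm _ _ hs
  cases hs with
  | child a b m h => exact rel_tail hm h
  | ins B y m h => exact absurd rfl (hS _ h)
  | del B y m h => exact absurd rfl (hS _ h)
  | repl a b m B B' _ _ h => exact absurd rfl (hS _ h)
  | text s s' m h => exact absurd rfl (hS _ h)

/-- The element types below which some member of `F` is attached. -/
def Below (D : DTD L) (F : Finset (UAT L)) (A : L) : Prop := ∃ u ∈ F, D.Le A u.src

/-- A step of `F` in a tree shows that some member of `F` is attached below its root type. -/
theorem Step.below_label {D : DTD L} {F : Finset (UAT L)} {A : L} {x y : UTree L}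
    (h : Step F x y) (hx : Inst D x) (hA : x.label = .elem A) : Below D F A := by
  induction h generalizing A with
  | child A' x y m h ih =>
    rw [label_elem, NodeLabel.elem.injEq] at hA
    subst hA
    obtain ⟨B, hB, -⟩ := h.label_eq
    have hm := Multiset.mem_cons_self x m
    obtain ⟨u, hu, hle⟩ := ih (hx.elem_inv.2.2 _ hm) hB
    exact ⟨u, hu, .head (hx.sub hm hB) hle⟩
  | here A' m n h =>
    rw [label_elem, NodeLabel.elem.injEq] at hA
    subst hA
    cases h with
    | child _ _ _ h => exact h.elim
    | ins _ _ _ h => exact ⟨_, h, .refl⟩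
    | del _ _ _ h => exact ⟨_, h, .refl⟩
    | repl _ _ _ _ _ _ _ h => exact ⟨_, h, .refl⟩
    | text _ _ _ h => exact ⟨_, h, .refl⟩

end Codes

/-! ### Local conditions for consistency -/

section LocalConditions

open UTree

variable {L : Type*} [DecidableEq L]

/-- The conditions, on each production rule separately, that make a policy with the allowed update
access types `S` and the forbidden ones `F` consistent. -/
structure LocallyConsistent (D : DTD L) (S F : Finset (UAT L)) : Prop where
  subset : S ⊆ D.valid
  subset' : F ⊆ D.valid
  disjoint : Disjoint S F
  insDel : ∀ A B, Below D F A → .ins A B ∈ S → .del A B ∉ S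
  replForbidden : ∀ A, D.Le D.root A → ∀ X Y,
    Relation.TransGen (fun X Y => UAT.repl A X Y ∈ S) X Y → .repl A X Y ∉ F
  replCycle : ∀ A, D.Le D.root A → ∀ X, Below D F X →
    ¬ Relation.TransGen (fun X Y => UAT.repl A X Y ∈ S) X X

theorem DTD.mem_valid {D : DTD L} {u : UAT L} :
    u ∈ D.valid ↔ ∃ A ∈ D.ele, u ∈ (D.rg A).validAt A := by
  simp [DTD.valid]

theorem DTD.ins_mem_valid {D : DTD L} {A B : L} :
    UAT.ins A B ∈ D.valid ↔ A ∈ D.ele ∧ D.rg A = .star B := by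
  rw [DTD.mem_valid]
  constructor
  · rintro ⟨A', h, hu⟩
    cases hr : D.rg A' <;> simp [hr, Content.validAt] at hu
    obtain ⟨rfl, rfl⟩ := hu
    exact ⟨h, hr⟩
  · rintro ⟨h, hr⟩
    exact ⟨A, h, by simp [hr, Content.validAt]⟩

theorem DTD.del_mem_valid {D : DTD L} {A B : L} :
    UAT.del A B ∈ D.valid ↔ A ∈ D.ele ∧ D.rg A = .star B := by
  rw [DTD.mem_valid]
  constructor
  · rintro ⟨A', h, hu⟩
    cases hr : D.rg A' <;> simp [hr, Content.validAt] at hu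
    obtain ⟨rfl, rfl⟩ := hu
    exact ⟨h, hr⟩
  · rintro ⟨h, hr⟩
    exact ⟨A, h, by simp [hr, Content.validAt]⟩

theorem DTD.repl_mem_valid {D : DTD L} {A X Y : L} :
    UAT.repl A X Y ∈ D.valid ↔ A ∈ D.ele ∧ ∃ l, D.rg A = .alt l ∧ X ∈ l ∧ Y ∈ l ∧ X ≠ Y := by
  rw [DTD.mem_valid]
  constructor
  · rintro ⟨A', h, hu⟩
    cases hr : D.rg A' <;> simp [hr, Content.validAt] at hu
    obtain ⟨hu, rfl⟩ := hu
    exact ⟨h, _, hr, hu.1.1, hu.1.2, hu.2⟩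
  · rintro ⟨h, l, hr, h1, h2, h3⟩
    exact ⟨A, h, by simp [hr, Content.validAt, h1, h2, h3]⟩

theorem DTD.replStr_mem_valid {D : DTD L} {A : L} :
    UAT.replStr A ∈ D.valid ↔ A ∈ D.ele ∧ D.rg A = .text := by
  rw [DTD.mem_valid]
  constructor
  · rintro ⟨A', h, hu⟩
    cases hr : D.rg A' <;> simp [hr, Content.validAt] at hu
    subst hu
    exact ⟨h, hr⟩
  · rintro ⟨h, hr⟩
    exact ⟨A, h, by simp [hr, Content.validAt]⟩

variable {D : DTD L} {S : Finset (UAT L)}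

/-- At a disjunction, a simulation either stays in the subtree or follows replacements at the
root. -/
theorem Reach.alt {A : L} {l : List L} (hS : S ⊆ D.valid) (hr : D.rg A = .alt l) {x : UTree L}
    {z : UTree L} (h : Reach D S (elem A {x}) z) :
    ∃ y, z = elem A {y} ∧ (Reach D S x y ∨ ∃ X Y, x.label = .elem X ∧ y.label = .elem Y ∧
      Relation.TransGen (fun X Y => UAT.repl A X Y ∈ S) X Y) := by
  have hone : ∀ m, Inst D (elem A m) → ∃ y, m = {y} := by
    intro m hm
    obtain ⟨-, ⟨w, hw, he⟩, -⟩ := hm.elem_inv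
    rw [hr] at hw
    obtain ⟨b, -, rfl⟩ := hw
    rw [← Multiset.card_eq_one, ← Multiset.card_map label, ← he]
    rfl
  suffices key : ∃ n, z = elem A n ∧ ∃ y, n = {y} ∧ (Reach D S x y ∨ ∃ X Y,
      x.label = .elem X ∧ y.label = .elem Y ∧
      Relation.TransGen (fun X Y => UAT.repl A X Y ∈ S) X Y) by
    obtain ⟨n, rfl, y, rfl, hy⟩ := key
    exact ⟨y, rfl, hy⟩
  · refine h.elem_induction _ ⟨x, rfl, .inl .refl⟩ ?_
    rintro m₁ m₂ ⟨y, rfl, hy⟩ i1 i2 hs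
    obtain ⟨y', rfl⟩ := hone _ i2
    refine ⟨y', rfl, ?_⟩
    have aux : ∀ {a b c d : UTree L} {m : Multiset (UTree L)}, a ::ₘ m = {c} → b ::ₘ m = {d} →
        a = c ∧ b = d := by
      intro a b c d m h1 h2
      have h0 : m = 0 := by simpa using congrArg Multiset.card h1
      subst h0
      exact ⟨by simpa using h1, by simpa using h2⟩
    generalize h1 : ({y} : Multiset (UTree L)) = m₁ at hs
    generalize h2 : ({y'} : Multiset (UTree L)) = m₂ at hs
    cases hs with
    | child a b m h =>
      obtain ⟨rfl, rfl⟩ := aux h1.symm h2.symm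
      rcases hy with hy | ⟨X, Y, hX, hY, ht⟩
      · exact .inl (hy.tail h)
      · obtain ⟨B, hB, hB'⟩ := h.2.2.label_eq
        exact .inr ⟨X, Y, hX, hB'.trans (hB.symm.trans hY), ht⟩
    | ins B y m h => have := (DTD.ins_mem_valid.1 (hS h)).2; simp [hr] at this
    | del B y m h => have := (DTD.del_mem_valid.1 (hS h)).2; simp [hr] at this
    | repl a b m B B' ha hb h =>
      obtain ⟨rfl, rfl⟩ := aux h1.symm h2.symm
      rcases hy with hy | ⟨X, Y, hX, hY, ht⟩
      · exact .inr ⟨B, B', hy.label_eq.trans ha, hb, .single h⟩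
      · rw [ha, NodeLabel.elem.injEq] at hY
        subst hY
        exact .inr ⟨X, B', hX, hb, ht.tail h⟩
    | text s s' m h => have := (DTD.replStr_mem_valid.1 (hS h)).2; simp [hr] at this

/-- At a star without allowed insertions, a simulation acts on each immediate subtree separately or
reduces their number. -/
theorem Reach.star_of_no_ins {A B : L} (hS : S ⊆ D.valid) (hr : D.rg A = .star B)
    (hi : .ins A B ∉ S) {m : Multiset (UTree L)} {z : UTree L} (h : Reach D S (elem A m) z) :
    ∃ n, z = elem A n ∧ (Multiset.Rel (Reach D S) m n ∨ n.card < m.card) := by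
  refine h.elem_induction _ (.inl (Multiset.rel_refl_of_refl_on fun _ _ => .refl)) ?_
  intro m₁ m₂ hm _ _ hs
  cases hs with
  | child a b m h =>
    refine hm.imp (rel_tail · h) fun hm => ?_
    simpa using hm
  | ins B' y m h =>
    have := (DTD.ins_mem_valid.1 (hS h)).2
    rw [hr, Content.star.injEq] at this
    exact absurd (this ▸ h) hi
  | del B y m h =>
    right
    rcases hm with hm | hm
    · rw [Multiset.card_eq_card_of_rel hm, Multiset.card_cons]; omega
    · rw [Multiset.card_cons] at hm; omega
  | repl a b m B B' _ _ h =>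
    obtain ⟨-, l, hl, -⟩ := DTD.repl_mem_valid.1 (hS h)
    simp [hr] at hl
  | text s s' m h => have := (DTD.replStr_mem_valid.1 (hS h)).2; simp [hr] at this

/-- At a star without allowed deletions, a simulation acts on each immediate subtree separately or
increases their number. -/
theorem Reach.star_of_no_del {A B : L} (hS : S ⊆ D.valid) (hr : D.rg A = .star B)
    (hi : .del A B ∉ S) {m : Multiset (UTree L)} {z : UTree L} (h : Reach D S (elem A m) z) :
    ∃ n, z = elem A n ∧ (Multiset.Rel (Reach D S) m n ∨ m.card < n.card) := by
  refine h.elem_induction _ (.inl (Multiset.rel_refl_of_refl_on fun _ _ => .refl)) ?_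
  intro m₁ m₂ hm _ _ hs
  cases hs with
  | child a b m h =>
    refine hm.imp (rel_tail · h) fun hm => ?_
    simpa using hm
  | del B' y m h =>
    have := (DTD.del_mem_valid.1 (hS h)).2
    rw [hr, Content.star.injEq] at this
    exact absurd (this ▸ h) hi
  | ins B y m h =>
    right
    rw [Multiset.card_cons]
    rcases hm with hm | hm
    · rw [Multiset.card_eq_card_of_rel hm]; omega
    · omega
  | repl a b m B B' _ _ h =>
    obtain ⟨-, l, hl, -⟩ := DTD.repl_mem_valid.1 (hS h)
    simp [hr] at hl
  | text s s' m h => have := (DTD.replStr_mem_valid.1 (hS h)).2; simp [hr] at this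

/-- The local conditions suffice: the effect of a forbidden update cannot be simulated. -/
theorem LocallyConsistent.not_reach {F : Finset (UAT L)} (hc : LocallyConsistent D S F)
    {x y : UTree L} {A : L} (h : Step F x y) (hx : Inst D x) (hy : Inst D y)
    (hA : x.label = .elem A) (hle : D.Le D.root A) : ¬ Reach D S x y := by
  have hb := h.below_label hx hA
  induction h generalizing A with
  | child A' x y m h ih =>
    intro hre
    rw [label_elem, NodeLabel.elem.injEq] at hA
    subst hA
    obtain ⟨B, hB, hB'⟩ := h.label_eq
    have hxm := Multiset.mem_cons_self x m
    have ix := hx.elem_inv.2.2 _ hxm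
    have iy := hy.elem_inv.2.2 _ (Multiset.mem_cons_self y m)
    have hs := hx.sub hxm hB
    have hb' := h.below_label ix hB
    refine ih ix iy hB (hle.tail hs) hb' ?_
    have fin : (∃ n, elem A' (y ::ₘ m) = elem A' n ∧ Multiset.Rel (Reach D S) (x ::ₘ m) n) →
        Reach D S x y := by
      rintro ⟨n, hn, hr⟩
      rw [← (elem_inj.1 hn).2] at hr
      exact rel_of_rel_cons_cons hr
    cases hr : D.rg A' with
    | text => simp [DTD.Sub, hr, Content.subs] at hs
    | empty => simp [DTD.Sub, hr, Content.subs] at hs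
    | seq l =>
      refine fin (hre.rel ?_)
      rintro u hu rfl
      cases u with
      | ins A B => have := (DTD.ins_mem_valid.1 (hc.subset hu)).2; simp_all [UAT.src]
      | del A B => have := (DTD.del_mem_valid.1 (hc.subset hu)).2; simp_all [UAT.src]
      | repl A B B' =>
        obtain ⟨-, l, hl, -⟩ := DTD.repl_mem_valid.1 (hc.subset hu); simp_all [UAT.src]
      | replStr A => have := (DTD.replStr_mem_valid.1 (hc.subset hu)).2; simp_all [UAT.src]
    | star C =>
      -- The number of subtrees is unchanged, which excludes the allowed one of insertions and
      -- deletions.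
      by_cases hi : .ins A' C ∈ S
      · obtain ⟨n, hn, hr⟩ := hre.star_of_no_del hc.subset hr (hc.insDel A' C hb hi)
        refine fin ⟨n, hn, hr.resolve_right fun hlt => ?_⟩
        simp [← (elem_inj.1 hn).2] at hlt
      · obtain ⟨n, hn, hr⟩ := hre.star_of_no_ins hc.subset hr hi
        refine fin ⟨n, hn, hr.resolve_right fun hlt => ?_⟩
        simp [← (elem_inj.1 hn).2] at hlt
    | alt l =>
      have hm : m = 0 := by
        obtain ⟨-, ⟨w, hw, he⟩, -⟩ := hx.elem_inv
        rw [hr] at hw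
        obtain ⟨b, -, rfl⟩ := hw
        simpa using congrArg Multiset.card he
      subst hm
      obtain ⟨y', hy', hr'⟩ := Reach.alt hc.subset hr hre
      have : y = y' := by simpa using (elem_inj.1 hy').2
      subst this
      refine hr'.resolve_right ?_
      rintro ⟨X, Y, hX, hY, ht⟩
      rw [hB, NodeLabel.elem.injEq] at hX
      rw [hB', NodeLabel.elem.injEq] at hY
      subst hX hY
      exact hc.replCycle A' hle _ hb' ht
  | here A' m n h =>
    intro hre
    rw [label_elem, NodeLabel.elem.injEq] at hA
    subst hA
    cases h with
    | child _ _ _ h => exact h.elim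
    | ins B z m h =>
      have hr := (DTD.ins_mem_valid.1 (hc.subset' h)).2
      have hi : .ins A' B ∉ S := fun hi => Finset.disjoint_left.1 hc.disjoint hi h
      obtain ⟨n, hn, hr⟩ := hre.star_of_no_ins hc.subset hr hi
      rw [← (elem_inj.1 hn).2] at hr
      rcases hr with hr | hr
      · simpa using Multiset.card_eq_card_of_rel hr
      · rw [Multiset.card_cons] at hr; omega
    | del B z m h =>
      have hr := (DTD.del_mem_valid.1 (hc.subset' h)).2
      have hi : .del A' B ∉ S := fun hi => Finset.disjoint_left.1 hc.disjoint hi h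
      obtain ⟨n, hn, hr⟩ := hre.star_of_no_del hc.subset hr hi
      rw [← (elem_inj.1 hn).2] at hr
      rcases hr with hr | hr
      · simpa using Multiset.card_eq_card_of_rel hr
      · rw [Multiset.card_cons] at hr; omega
    | repl x y m B B' hB hB' h =>
      obtain ⟨-, l, hr, -, -, hne⟩ := DTD.repl_mem_valid.1 (hc.subset' h)
      have hm : m = 0 := by
        obtain ⟨-, ⟨w, hw, he⟩, -⟩ := hx.elem_inv
        rw [hr] at hw
        obtain ⟨b, -, rfl⟩ := hw
        simpa using congrArg Multiset.card he
      subst hm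
      obtain ⟨y', hy', hr'⟩ := Reach.alt hc.subset hr hre
      have : y = y' := by simpa using (elem_inj.1 hy').2
      subst this
      rcases hr' with hr' | ⟨X, Y, hX, hY, ht⟩
      · have := hr'.label_eq
        rw [hB, hB', NodeLabel.elem.injEq] at this
        exact hne this
      · rw [hB, NodeLabel.elem.injEq] at hX
        rw [hB', NodeLabel.elem.injEq] at hY
        subst hX hY
        exact hc.replForbidden A' hle _ _ ht h
    | text s s' m h hne =>
      have hr := (DTD.replStr_mem_valid.1 (hc.subset' h)).2
      have hno : ∀ u ∈ S, u.src ≠ A' := by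
        rintro u hu rfl
        cases u with
        | ins A B => have := (DTD.ins_mem_valid.1 (hc.subset hu)).2; simp_all [UAT.src]
        | del A B => have := (DTD.del_mem_valid.1 (hc.subset hu)).2; simp_all [UAT.src]
        | repl A B B' =>
          obtain ⟨-, l, hl, -⟩ := DTD.repl_mem_valid.1 (hc.subset hu); simp_all [UAT.src]
        | replStr A => exact Finset.disjoint_left.1 hc.disjoint hu h
      obtain ⟨n, hn, hr⟩ := hre.rel hno
      rw [← (elem_inj.1 hn).2] at hr
      exact hne (text_inj.1 (Reach.text_eq (rel_of_rel_cons_cons hr))).symm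

end LocalConditions

/-! ### Codes of XML trees -/

namespace XMLTree

open UTree

section

variable {L : Type*}

/-- The data at a node that matter up to isomorphism: its element type or its string. -/
def key (t : XMLTree L) (n : ℕ) : L ⊕ String :=
  match t.label n with
  | .elem a => .inl a
  | .str => .inr (t.val n)

theorem key_of_elem {t : XMLTree L} {n : ℕ} {A : L} (h : t.label n = .elem A) :
    t.key n = .inl A := by
  simp [key, h]

theorem key_of_str {t : XMLTree L} {n : ℕ} (h : t.label n = .str) :
    t.key n = .inr (t.val n) := by
  simp [key, h]

theorem key_congr {t t' : XMLTree L} {n n' : ℕ} (h : t.label n = t'.label n')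
    (hv : t.label n = .str → t.val n = t'.val n') : t.key n = t'.key n' := by
  cases hl : t.label n with
  | elem A => rw [key_of_elem hl, key_of_elem (h ▸ hl)]
  | str => rw [key_of_str hl, key_of_str (h ▸ hl), hv hl]

theorem mem_children {t : XMLTree L} {m c : ℕ} : c ∈ t.children m ↔ c ∈ t.nodes ∧ t.Edge m c := by
  simp [children, Edge]

/-- `HasCode t n x`: the subtree of `t` at the node `n` is well-founded and has the code `x`. -/
inductive HasCode (t : XMLTree L) : ℕ → UTree L → Prop
  | mk (n : ℕ) (f : ℕ → UTree L) : (∀ c ∈ t.children n, HasCode t c (f c)) →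
      HasCode t n (node (t.key n, (t.children n).val.map f))

theorem HasCode.unique {t : XMLTree L} {n : ℕ} {x y : UTree L} (hx : HasCode t n x)
    (hy : HasCode t n y) : x = y := by
  induction hx generalizing y with
  | mk n f hf ih =>
    cases hy with
    | mk _ g hg =>
      congr 2
      exact Multiset.map_congr rfl fun c hc => ih c hc (hg c hc)

/-- Transfer of codes along a map of nodes which, on a set `Q` of nodes that is closed under taking
children, preserves keys and sets of children. -/
theorem HasCode.transfer {t t' : XMLTree L} (h : ℕ → ℕ) (Q : ℕ → Prop)
    (hQ : ∀ m, Q m → t'.children (h m) = (t.children m).image h ∧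
      Set.InjOn h (t.children m) ∧ t'.key (h m) = t.key m ∧ ∀ c ∈ t.children m, Q c)
    {n : ℕ} {x : UTree L} (hx : HasCode t n x) (hn : Q n) : HasCode t' (h n) x := by
  induction hx with
  | mk n f hf ih =>
    obtain ⟨h1, h2, h3, h4⟩ := hQ n hn
    set g := f ∘ Function.invFunOn h (t.children n : Set ℕ) with hg
    have hgh : ∀ c ∈ t.children n, g (h c) = f c := fun c hc => by
      simp only [hg, Function.comp]
      rw [h2.leftInvOn_invFunOn hc]
    have key : HasCode t' (h n) (node (t'.key (h n), (t'.children (h n)).val.map g)) := by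
      refine .mk _ g fun c hc => ?_
      rw [h1, Finset.mem_image] at hc
      obtain ⟨c, hc, rfl⟩ := hc
      rw [hgh c hc]
      exact ih c hc (h4 c hc)
    rw [h1, h3, Finset.image_val_of_injOn h2, Multiset.map_map] at key
    have hmap : (t.children n).val.map (g ∘ h) = (t.children n).val.map f :=
      Multiset.map_congr rfl hgh
    rwa [hmap] at key

/-- The code of the subtree at a node (an arbitrary value if there is none). -/
noncomputable def code (t : XMLTree L) (n : ℕ) : UTree L := Classical.epsilon (HasCode t n)

theorem HasCode.code_eq {t : XMLTree L} {n : ℕ} {x : UTree L} (h : HasCode t n x) :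
    t.code n = x :=
  (Classical.epsilon_spec ⟨x, h⟩ : HasCode t n (t.code n)).unique h

/-! ### Trees -/

namespace IsTree

variable {t : XMLTree L} (ht : t.IsTree)

include ht

theorem parent_unique {p q n : ℕ} (hp : t.Edge p n) (hq : t.Edge q n) : p = q := by
  have hn := (ht.edges_mem _ _ hp).2
  have hr : n ≠ t.root := by
    rintro rfl
    exact ht.root_no_parent _ hp
  exact (ht.unique_parent n hn hr).unique hp hq

theorem not_transGen_self (n : ℕ) : ¬ Relation.TransGen t.Edge n n := by
  intro h
  have hn : n ∈ t.nodes := by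
    cases h with
    | single h => exact (ht.edges_mem _ _ h).1
    | tail _ h => exact (ht.edges_mem _ _ h).2
  have hr := ht.reachable n hn
  clear hn
  induction hr with
  | refl =>
    cases h with
    | single h => exact ht.root_no_parent _ h
    | tail _ h => exact ht.root_no_parent _ h
  | tail _ hbc ih =>
    apply ih
    obtain ⟨d, hd, hdc⟩ := Relation.TransGen.tail'_iff.1 h
    rw [← ht.parent_unique hbc hdc] at hd
    exact Relation.TransGen.head' hbc hd

theorem ancestor_total {a b n : ℕ} (ha : Relation.ReflTransGen t.Edge a n)
    (hb : Relation.ReflTransGen t.Edge b n) :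
    Relation.ReflTransGen t.Edge a b ∨ Relation.ReflTransGen t.Edge b a := by
  have hU : Relator.RightUnique (Function.swap t.Edge) := fun _ _ _ h1 h2 =>
    ht.parent_unique h1 h2
  have := Relation.ReflTransGen.total_of_right_unique hU ha.swap hb.swap
  exact this.symm.imp (fun h => by simpa using h.swap) (fun h => by simpa using h.swap)

/-- The proper ancestors of a node are the ancestors of its parent. -/
theorem ancestor_parent {a p n : ℕ} (h : Relation.ReflTransGen t.Edge a n) (hp : t.Edge p n) :
    a = n ∨ Relation.ReflTransGen t.Edge a p := by
  rcases Relation.ReflTransGen.cases_tail h with h | ⟨q, hq, hqn⟩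
  · exact .inl h.symm
  · rw [ht.parent_unique hp hqn]
    exact .inr hq

end IsTree

/-! ### Codes of instances -/

namespace Conforms

variable {D : DTD L} {R : L} {t : XMLTree L} (ht : Conforms D R t)

include ht

theorem mem_ele {n : ℕ} (hn : n ∈ t.nodes) {A : L} (hA : t.label n = .elem A) : A ∈ D.ele := by
  rcases ht.labels n hn with h | ⟨B, hB, h⟩
  · simp [hA] at h
  · rw [hA, NodeLabel.elem.injEq] at h
    exact h ▸ hB

theorem sub {n c : ℕ} (hn : n ∈ t.nodes) {A B : L} (hA : t.label n = .elem A)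
    (hc : c ∈ t.children n) (hB : t.label c = .elem B) : D.Sub A B := by
  refine ⟨ht.mem_ele hn hA, ?_⟩
  obtain ⟨w, hw, he⟩ := ht.content n hn A hA
  refine Content.mem_subs_of_mem_lang hw ?_
  rw [← Multiset.mem_coe, he, Multiset.mem_map]
  exact ⟨c, hc, hB⟩

theorem hasCode_of_str {n : ℕ} (hn : n ∈ t.nodes) (h : t.label n = .str) :
    HasCode t n (text (t.val n)) := by
  have he := ht.text_leaf n hn h
  have := HasCode.mk (t := t) n (fun _ => text (t.val n)) (by simp [he])
  rw [he, key_of_str h] at this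
  exact this

theorem exists_hasCode {n : ℕ} (hn : n ∈ t.nodes) : ∃ x, HasCode t n x := by
  cases h : t.label n with
  | str => exact ⟨_, ht.hasCode_of_str hn h⟩
  | elem A =>
    induction hk : (D.strictlyBelow A).card using Nat.strong_induction_on generalizing A n with
    | _ k ih =>
      have : ∀ c, ∃ x, c ∈ t.children n → HasCode t c x := by
        intro c
        by_cases hc : c ∈ t.children n
        · have hcn := (mem_children.1 hc).1
          cases hl : t.label c with
          | str => exact ⟨_, fun _ => ht.hasCode_of_str hcn hl⟩
          | elem B =>
            obtain ⟨x, hx⟩ := ih _ (hk ▸ DTD.card_strictlyBelow_lt (ht.sub hn h hc hl)) hcn B hl rfl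
            exact ⟨x, fun _ => hx⟩
        · exact ⟨t.code n, fun h => absurd h hc⟩
      choose f hf using this
      exact ⟨_, .mk n f hf⟩

theorem hasCode_code {n : ℕ} (hn : n ∈ t.nodes) : HasCode t n (t.code n) := by
  obtain ⟨x, hx⟩ := ht.exists_hasCode hn
  rwa [hx.code_eq]

theorem code_of_str {n : ℕ} (hn : n ∈ t.nodes) (h : t.label n = .str) :
    t.code n = text (t.val n) :=
  (ht.hasCode_of_str hn h).code_eq

theorem code_of_elem {n : ℕ} {A : L} (h : t.label n = .elem A) :
    t.code n = UTree.elem A ((t.children n).val.map t.code) := by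
  have := HasCode.mk n t.code fun c hc => ht.hasCode_code (mem_children.1 hc).1
  rw [key_of_elem h] at this
  exact this.code_eq

theorem label_code {n : ℕ} (hn : n ∈ t.nodes) : (t.code n).label = t.label n := by
  cases h : t.label n with
  | str => rw [ht.code_of_str hn h, label_text]
  | elem A => rw [ht.code_of_elem h, label_elem]

theorem inst_code {n : ℕ} (hn : n ∈ t.nodes) : Inst D (t.code n) := by
  have hx := ht.hasCode_code hn
  generalize t.code n = x at hx
  induction hx with
  | mk n f hf ih =>
    have hf' : (t.children n).val.map f = (t.children n).val.map t.code :=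
      Multiset.map_congr rfl fun c hc => (hf c hc).code_eq.symm
    cases h : t.label n with
    | str =>
      rw [ht.text_leaf n hn h, key_of_str h]
      exact .text _
    | elem A =>
      rw [key_of_elem h]
      refine .elem A _ (ht.mem_ele hn h) ?_ ?_
      · obtain ⟨w, hw, he⟩ := ht.content n hn A h
        refine ⟨w, hw, ?_⟩
        rw [he, hf', Multiset.map_map]
        exact Multiset.map_congr rfl fun c hc => (ht.label_code (mem_children.1 hc).1).symm
      · intro x hx
        obtain ⟨c, hc, rfl⟩ := Multiset.mem_map.1 hx
        exact ih c hc (mem_children.1 hc).1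

/-- Only element nodes have children. -/
theorem label_of_edge {p n : ℕ} (h : t.Edge p n) : ∃ A, t.label p = .elem A := by
  obtain ⟨hp, hn⟩ := ht.isTree.edges_mem _ _ h
  cases hl : t.label p with
  | elem A => exact ⟨A, rfl⟩
  | str =>
    have : n ∈ t.children p := mem_children.2 ⟨hn, h⟩
    simp [ht.text_leaf p hp hl] at this

end Conforms

theorem Iso.refl (t : XMLTree L) : Iso t t :=
  ⟨id, Set.bijOn_id _, rfl, fun _ _ _ _ => Iff.rfl, fun _ _ => rfl, fun _ _ _ => rfl⟩

/-- Isomorphic trees have the same code. -/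
theorem Iso.code_eq {D : DTD L} {R : L} {t t' : XMLTree L} (ht : Conforms D R t) (h : Iso t t') :
    t'.code t'.root = t.code t.root := by
  obtain ⟨h, hb, hr, he, hl, hv⟩ := h
  have := (ht.hasCode_code ht.isTree.root_mem).transfer (t' := t') h (· ∈ t.nodes) ?_
    ht.isTree.root_mem
  · rw [hr] at this
    exact this.code_eq
  · intro m hm
    refine ⟨?_, hb.injOn.mono fun c hc => (mem_children.1 hc).1,
      (key_congr (hl m hm) (hv m hm)).symm, fun c hc => (mem_children.1 hc).1⟩
    ext c
    rw [mem_children, Finset.mem_image]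
    constructor
    · rintro ⟨hc, hmc⟩
      obtain ⟨c, hcn, rfl⟩ := hb.surjOn hc
      exact ⟨c, mem_children.2 ⟨hcn, (he m hm c hcn).2 hmc⟩, rfl⟩
    · rintro ⟨c, hc, rfl⟩
      obtain ⟨hc, hmc⟩ := mem_children.1 hc
      exact ⟨hb.mapsTo hc, (he m hm c hc).1 hmc⟩

/-! ### Changing a tree below one node -/

/-- `t'` arises from `t` by a change of the children of the node `p`; `T` contains the descendants
of `p` that are affected. -/
structure ChangedBelow (t t' : XMLTree L) (p : ℕ) (T : ℕ → Prop) : Prop where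
  mem : p ∈ t.nodes
  mem' : p ∈ t'.nodes
  label : t'.label p = t.label p
  root : t'.root = t.root
  below : ∀ c, T c → Relation.TransGen t.Edge p c
  parent : ∀ m c, t.Edge m c → T c → m = p ∨ T m
  frame : ∀ m ∈ t.nodes, m ≠ p → ¬ T m →
    m ∈ t'.nodes ∧ t'.children m = t.children m ∧ t'.key m = t.key m

/-- Subtrees that contain neither `p` nor an affected node keep their codes. -/
theorem ChangedBelow.code_eq {D : DTD L} {R : L} {t t' : XMLTree L} {p : ℕ} {T : ℕ → Prop}
    (h : ChangedBelow t t' p T) (ht : Conforms D R t) {m : ℕ} (hm : m ∈ t.nodes)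
    (hmp : ¬ Relation.ReflTransGen t.Edge m p) (hT : ¬ T m) : t'.code m = t.code m := by
  refine ((ht.hasCode_code hm).transfer (t' := t') id
    (fun m => m ∈ t.nodes ∧ ¬ Relation.ReflTransGen t.Edge m p ∧ ¬ T m) ?_ ⟨hm, hmp, hT⟩).code_eq
  rintro m ⟨hm, hmp, hT⟩
  have hne : m ≠ p := by rintro rfl; exact hmp .refl
  obtain ⟨-, h1, h2⟩ := h.frame m hm hne hT
  refine ⟨by simpa using h1, Set.injOn_id _, h2, fun c hc => ?_⟩
  obtain ⟨hc, hmc⟩ := mem_children.1 hc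
  exact ⟨hc, fun hcp => hmp (.head hmc hcp), fun hTc => (h.parent m c hmc hTc).elim hne hT⟩

theorem ChangedBelow.code_child_eq {D : DTD L} {R : L} {t t' : XMLTree L} {p : ℕ} {T : ℕ → Prop}
    (h : ChangedBelow t t' p T) (ht : Conforms D R t) {c : ℕ} (hc : t.Edge p c) (hT : ¬ T c) :
    t'.code c = t.code c :=
  h.code_eq ht (ht.isTree.edges_mem _ _ hc).2
    (fun hcp => ht.isTree.not_transGen_self p (Relation.TransGen.head' hc hcp)) hT

/-- A step at a node is a step at the root. -/
theorem ChangedBelow.step {D : DTD L} {R : L} {t t' : XMLTree L} {p : ℕ} {T : ℕ → Prop}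
    (h : ChangedBelow t t' p T) (ht : Conforms D R t) (ht' : Conforms D R t')
    {S : Finset (UAT L)} (hs : Step S (t.code p) (t'.code p)) :
    Step S (t.code t.root) (t'.code t'.root) := by
  have htr := ht.isTree
  rw [h.root]
  have hroot := htr.reachable p h.mem
  generalize t.root = r at hroot
  induction hroot using Relation.ReflTransGen.head_induction_on with
  | refl => exact hs
  | head hqc hcp ih =>
    rename_i q c
    obtain ⟨hq, hc⟩ := htr.edges_mem _ _ hqc
    have hne : q ≠ p := by
      rintro rfl
      exact htr.not_transGen_self _ (Relation.TransGen.head' hqc hcp)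
    have hT : ¬ T q := fun hT =>
      htr.not_transGen_self p ((h.below q hT).trans_left (.head hqc hcp))
    obtain ⟨hq', hch, hkey⟩ := h.frame q hq hne hT
    obtain ⟨A, hA⟩ := ht.label_of_edge hqc
    have hA' : t'.label q = .elem A := by
      rw [key_of_elem hA] at hkey
      unfold key at hkey
      split at hkey <;> simp_all
    rw [ht.code_of_elem hA, ht'.code_of_elem hA', hch]
    have hmem : c ∈ (t.children q).val := mem_children.2 ⟨hc, hqc⟩
    rw [← Multiset.cons_erase hmem, Multiset.map_cons, Multiset.map_cons]
    -- The subtrees at the siblings of `c` contain neither `p` nor an affected node.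
    have : ((t.children q).val.erase c).map t'.code = ((t.children q).val.erase c).map t.code := by
      refine Multiset.map_congr rfl fun c' hc' => ?_
      rw [(t.children q).nodup.mem_erase_iff] at hc'
      obtain ⟨hcc, hc'⟩ := hc'
      obtain ⟨hcn, hqc'⟩ := mem_children.1 hc'
      have hnp : ¬ Relation.ReflTransGen t.Edge c' p := by
        intro hcp'
        rcases htr.ancestor_total hcp hcp' with hh | hh
        · rcases htr.ancestor_parent hh hqc' with hh | hh
          · exact hcc hh.symm
          · exact htr.not_transGen_self q (Relation.TransGen.head' hqc hh)
        · rcases htr.ancestor_parent hh hqc with hh | hh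
          · exact hcc hh
          · exact htr.not_transGen_self q (Relation.TransGen.head' hqc' hh)
      refine h.code_eq ht hcn hnp fun hTc => ?_
      exact (h.parent q c' hqc' hTc).elim hne hT
    rw [this]
    exact .child _ _ _ _ ih

/-! ### The effect of updates on trees -/

/-- `t` conforms to `D` except that the children of the node `p` are arbitrary. -/
structure ConformsOff (D : DTD L) (R : L) (p : ℕ) (t : XMLTree L) : Prop where
  isTree : t.IsTree
  root_label : t.label t.root = .elem R
  labels : ∀ n ∈ t.nodes, t.label n = .str ∨ ∃ B ∈ D.ele, t.label n = .elem B
  content : ∀ n ∈ t.nodes, n ≠ p → ∀ B, t.label n = .elem B →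
    ∃ w ∈ (D.rg B).lang, (w : Multiset (NodeLabel L)) = (t.children n).val.map t.label
  text_leaf : ∀ n ∈ t.nodes, n ≠ p → t.label n = .str → t.children n = ∅

theorem Conforms.off {D : DTD L} {R : L} {t : XMLTree L} (ht : Conforms D R t) (p : ℕ) :
    ConformsOff D R p t :=
  ⟨ht.isTree, ht.root_label, ht.labels, fun n hn _ => ht.content n hn,
    fun n hn _ => ht.text_leaf n hn⟩

theorem ConformsOff.conforms {D : DTD L} {R : L} {t : XMLTree L} {p : ℕ} {A : L}
    (ht : ConformsOff D R p t) (hA : t.label p = .elem A)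
    (hw : ∃ w ∈ (D.rg A).lang, (w : Multiset (NodeLabel L)) = (t.children p).val.map t.label) :
    Conforms D R t where
  isTree := ht.isTree
  root_label := ht.root_label
  labels := ht.labels
  content n hn B hB := by
    by_cases hnp : n = p
    · subst hnp
      rw [hA, NodeLabel.elem.injEq] at hB
      exact hB ▸ hw
    · exact ht.content n hn hnp B hB
  text_leaf n hn hs := by
    refine ht.text_leaf n hn ?_ hs
    rintro rfl
    simp [hA] at hs

section Delete

variable {t : XMLTree L} {n : ℕ}

theorem mem_desc {m : ℕ} : m ∈ t.desc n ↔ m ∈ t.nodes ∧ Relation.ReflTransGen t.Edge n m := by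
  simp [desc]

theorem edge_delete {x y : ℕ} :
    ((Op.delete n).apply t).Edge x y ↔ t.Edge x y ∧ x ∉ t.desc n ∧ y ∉ t.desc n := by
  simp [Edge, Op.apply]

theorem mem_nodes_delete {m : ℕ} :
    m ∈ ((Op.delete n).apply t).nodes ↔ m ∈ t.nodes ∧ m ∉ t.desc n := by
  simp [Op.apply]

theorem IsTree.root_notMem_desc (ht : t.IsTree) (hn : n ≠ t.root) : t.root ∉ t.desc n := by
  intro h
  rcases Relation.ReflTransGen.cases_tail (mem_desc.1 h).2 with h | ⟨q, -, h⟩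
  · exact hn h.symm
  · exact ht.root_no_parent _ h

theorem IsTree.desc_closed (ht : t.IsTree) {x y : ℕ} (h : t.Edge x y) (hx : x ∈ t.desc n) :
    y ∈ t.desc n :=
  mem_desc.2 ⟨(ht.edges_mem _ _ h).2, (mem_desc.1 hx).2.tail h⟩

theorem IsTree.delete (ht : t.IsTree) (hn : n ≠ t.root) : ((Op.delete n).apply t).IsTree where
  root_mem := mem_nodes_delete.2 ⟨ht.root_mem, ht.root_notMem_desc hn⟩
  edges_mem x y h := by
    obtain ⟨h, hx, hy⟩ := edge_delete.1 h
    obtain ⟨hx', hy'⟩ := ht.edges_mem _ _ h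
    exact ⟨mem_nodes_delete.2 ⟨hx', hx⟩, mem_nodes_delete.2 ⟨hy', hy⟩⟩
  root_no_parent x h := ht.root_no_parent x (edge_delete.1 h).1
  unique_parent m hm hr := by
    obtain ⟨hm, hmd⟩ := mem_nodes_delete.1 hm
    obtain ⟨p, hp, hu⟩ := ht.unique_parent m hm hr
    exact ⟨p, edge_delete.2 ⟨hp, fun hpd => hmd (ht.desc_closed hp hpd), hmd⟩,
      fun q hq => hu q (edge_delete.1 hq).1⟩
  reachable m hm := by
    obtain ⟨hm, hmd⟩ := mem_nodes_delete.1 hm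
    have hr := ht.reachable m hm
    clear hm
    induction hr with
    | refl => exact .refl
    | tail _ hbc ih =>
      have hb := fun hbd => hmd (ht.desc_closed hbc hbd)
      exact (ih (mem_nodes_delete.2 ⟨(ht.edges_mem _ _ hbc).1, hb⟩) hb).tail
        (edge_delete.2 ⟨hbc, hb, hmd⟩)

/-- Outside the deleted subtree only the parent of its root loses a child. -/
theorem IsTree.children_delete_of_ne (ht : t.IsTree) {p m : ℕ} (hp : t.Edge p n) (hm : m ≠ p)
    (hmd : m ∉ t.desc n) : ((Op.delete n).apply t).children m = t.children m := by
  ext c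
  rw [mem_children, mem_children, edge_delete, mem_nodes_delete]
  constructor
  · rintro ⟨⟨hc, -⟩, h, -⟩
    exact ⟨hc, h⟩
  · rintro ⟨hc, h⟩
    have hcd : c ∉ t.desc n := by
      intro hcd
      rcases ht.ancestor_parent (mem_desc.1 hcd).2 h with rfl | h'
      · exact hm (ht.parent_unique h hp)
      · exact hmd (mem_desc.2 ⟨(ht.edges_mem _ _ h).1, h'⟩)
    exact ⟨⟨hc, hcd⟩, h, hmd, hcd⟩

theorem IsTree.parent_notMem_desc (ht : t.IsTree) {p : ℕ} (hp : t.Edge p n) : p ∉ t.desc n :=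
  fun h => ht.not_transGen_self n (Relation.TransGen.tail' (mem_desc.1 h).2 hp)

theorem IsTree.notMem_desc_of_sibling (ht : t.IsTree) {p c : ℕ} (hp : t.Edge p n)
    (hc : t.Edge p c) (hne : c ≠ n) : c ∉ t.desc n := by
  intro hcd
  rcases ht.ancestor_parent (mem_desc.1 hcd).2 hc with h' | h'
  · exact hne h'.symm
  · exact ht.not_transGen_self n (Relation.TransGen.tail' h' hp)

theorem IsTree.children_delete (ht : t.IsTree) {p : ℕ} (hp : t.Edge p n) :
    ((Op.delete n).apply t).children p = (t.children p).erase n := by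
  ext c
  rw [mem_children, Finset.mem_erase, mem_children, edge_delete, mem_nodes_delete]
  constructor
  · rintro ⟨⟨hc, hcd⟩, h, -⟩
    refine ⟨?_, hc, h⟩
    rintro rfl
    exact hcd (mem_desc.2 ⟨hc, .refl⟩)
  · rintro ⟨hne, hc, h⟩
    have hcd := ht.notMem_desc_of_sibling hp h hne
    exact ⟨⟨hc, hcd⟩, h, ht.parent_notMem_desc hp, hcd⟩

theorem Conforms.delete {D : DTD L} {R : L} (ht : Conforms D R t) {p : ℕ} (hp : t.Edge p n) :
    ConformsOff D R p ((Op.delete n).apply t) where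
  isTree := ht.isTree.delete fun h => ht.isTree.root_no_parent p (h ▸ hp)
  root_label := ht.root_label
  labels m hm := ht.labels m (mem_nodes_delete.1 hm).1
  content m hm hmp B hB := by
    obtain ⟨hm, hmd⟩ := mem_nodes_delete.1 hm
    rw [ht.isTree.children_delete_of_ne hp hmp hmd]
    exact ht.content m hm B hB
  text_leaf m hm hmp hs := by
    obtain ⟨hm, hmd⟩ := mem_nodes_delete.1 hm
    rw [ht.isTree.children_delete_of_ne hp hmp hmd]
    exact ht.text_leaf m hm hs

theorem IsTree.changedBelow_delete (ht : t.IsTree) {p : ℕ} (hp : t.Edge p n) :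
    ChangedBelow t ((Op.delete n).apply t) p (· ∈ t.desc n) where
  mem := (ht.edges_mem _ _ hp).1
  mem' := mem_nodes_delete.2 ⟨(ht.edges_mem _ _ hp).1, ht.parent_notMem_desc hp⟩
  label := rfl
  root := rfl
  below c hc := Relation.TransGen.head' hp (mem_desc.1 hc).2
  parent m c hmc hc := by
    rcases ht.ancestor_parent (mem_desc.1 hc).2 hmc with rfl | h'
    · exact .inl (ht.parent_unique hmc hp)
    · exact .inr (mem_desc.2 ⟨(ht.edges_mem _ _ hmc).1, h'⟩)
  frame m hm hmp hmd :=
    ⟨mem_nodes_delete.2 ⟨hm, hmd⟩, ht.children_delete_of_ne hp hmp hmd, rfl⟩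

end Delete

section Insert

variable {t u : XMLTree L} {n : ℕ}

theorem edge_insert {x y : ℕ} : ((Op.insert n u).apply t).Edge x y ↔
    t.Edge x y ∨ u.Edge x y ∨ (x = n ∧ y = u.root) := by
  simp only [Edge, Op.apply, Finset.mem_union, Finset.mem_singleton, Prod.mk.injEq, or_assoc]

theorem mem_nodes_insert {m : ℕ} :
    m ∈ ((Op.insert n u).apply t).nodes ↔ m ∈ t.nodes ∨ m ∈ u.nodes := by
  simp [Op.apply]

theorem label_insert_of_mem {m : ℕ} (hm : m ∈ u.nodes) :
    ((Op.insert n u).apply t).label m = u.label m := by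
  simp [Op.apply, hm]

theorem label_insert_of_notMem {m : ℕ} (hm : m ∉ u.nodes) :
    ((Op.insert n u).apply t).label m = t.label m := by
  simp [Op.apply, hm]

theorem key_insert_of_notMem {m : ℕ} (hm : m ∉ u.nodes) :
    ((Op.insert n u).apply t).key m = t.key m :=
  key_congr (label_insert_of_notMem hm) fun _ => by simp [Op.apply, hm]

variable (ht : t.IsTree) (hu : u.IsTree) (hd : Disjoint t.nodes u.nodes)

include ht hu hd

theorem IsTree.insert (hn : n ∈ t.nodes) : ((Op.insert n u).apply t).IsTree where
  root_mem := mem_nodes_insert.2 (.inl ht.root_mem)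
  edges_mem x y h := by
    rw [mem_nodes_insert, mem_nodes_insert]
    rcases edge_insert.1 h with h | h | ⟨rfl, rfl⟩
    · exact (ht.edges_mem _ _ h).imp .inl .inl
    · exact (hu.edges_mem _ _ h).imp .inr .inr
    · exact ⟨.inl hn, .inr hu.root_mem⟩
  root_no_parent x h := by
    rcases edge_insert.1 h with h | h | ⟨-, h⟩
    · exact ht.root_no_parent x h
    · exact Finset.disjoint_left.1 hd ht.root_mem (hu.edges_mem _ _ h).2
    · exact Finset.disjoint_left.1 hd ht.root_mem (h ▸ hu.root_mem)
  unique_parent m hm hr := by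
    rcases mem_nodes_insert.1 hm with hm | hm
    · obtain ⟨p, hp, hq⟩ := ht.unique_parent m hm hr
      refine ⟨p, edge_insert.2 (.inl hp), fun q h => ?_⟩
      rcases edge_insert.1 h with h | h | ⟨-, rfl⟩
      · exact hq q h
      · exact absurd (hu.edges_mem _ _ h).2 (Finset.disjoint_left.1 hd hm)
      · exact absurd hu.root_mem (Finset.disjoint_left.1 hd hm)
    · by_cases hmr : m = u.root
      · subst hmr
        refine ⟨n, edge_insert.2 (.inr (.inr ⟨rfl, rfl⟩)), fun q h => ?_⟩
        rcases edge_insert.1 h with h | h | ⟨rfl, -⟩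
        · exact absurd hm (Finset.disjoint_left.1 hd (ht.edges_mem _ _ h).2)
        · exact absurd h (hu.root_no_parent q)
        · rfl
      · obtain ⟨p, hp, hq⟩ := hu.unique_parent m hm hmr
        refine ⟨p, edge_insert.2 (.inr (.inl hp)), fun q h => ?_⟩
        rcases edge_insert.1 h with h | h | ⟨-, h⟩
        · exact absurd hm (Finset.disjoint_left.1 hd (ht.edges_mem _ _ h).2)
        · exact hq q h
        · exact absurd h hmr
  reachable m hm := by
    have h1 : ∀ m ∈ t.nodes, Relation.ReflTransGen ((Op.insert n u).apply t).Edge t.root m :=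
      fun m hm => (ht.reachable m hm).lift id fun _ _ h => edge_insert.2 (.inl h)
    rcases mem_nodes_insert.1 hm with hm | hm
    · exact h1 m hm
    · exact ((h1 n hn).tail (edge_insert.2 (.inr (.inr ⟨rfl, rfl⟩)))).trans
        ((hu.reachable m hm).lift id fun _ _ h => edge_insert.2 (.inr (.inl h)))

theorem children_insert_of_ne {m : ℕ} (hm : m ∈ t.nodes) (hne : m ≠ n) :
    ((Op.insert n u).apply t).children m = t.children m := by
  ext c
  rw [mem_children, mem_children, edge_insert, mem_nodes_insert]
  constructor
  · rintro ⟨-, h | h | ⟨h, -⟩⟩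
    · exact ⟨(ht.edges_mem _ _ h).2, h⟩
    · exact absurd (hu.edges_mem _ _ h).1 (Finset.disjoint_left.1 hd hm)
    · exact absurd h hne
  · rintro ⟨hc, h⟩
    exact ⟨.inl hc, .inl h⟩

theorem children_insert_of_mem (hn : n ∈ t.nodes) {m : ℕ} (hm : m ∈ u.nodes) :
    ((Op.insert n u).apply t).children m = u.children m := by
  ext c
  rw [mem_children, mem_children, edge_insert, mem_nodes_insert]
  constructor
  · rintro ⟨-, h | h | ⟨rfl, -⟩⟩
    · exact absurd hm (Finset.disjoint_left.1 hd (ht.edges_mem _ _ h).1)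
    · exact ⟨(hu.edges_mem _ _ h).2, h⟩
    · exact absurd hm (Finset.disjoint_left.1 hd hn)
  · rintro ⟨hc, h⟩
    exact ⟨.inr hc, .inr (.inl h)⟩

theorem children_insert (hn : n ∈ t.nodes) :
    (((Op.insert n u).apply t).children n).val = u.root ::ₘ (t.children n).val := by
  have hr : u.root ∉ t.children n := fun h =>
    Finset.disjoint_left.1 hd (mem_children.1 h).1 hu.root_mem
  rw [← Finset.cons_val hr]
  congr 1
  ext c
  rw [Finset.mem_cons, mem_children, mem_children, edge_insert, mem_nodes_insert]
  constructor
  · rintro ⟨-, h | h | ⟨-, h⟩⟩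
    · exact .inr ⟨(ht.edges_mem _ _ h).2, h⟩
    · exact absurd (hu.edges_mem _ _ h).1 (Finset.disjoint_left.1 hd hn)
    · exact .inl h
  · rintro (rfl | ⟨hc, h⟩)
    · exact ⟨.inr hu.root_mem, .inr (.inr ⟨rfl, rfl⟩)⟩
    · exact ⟨.inl hc, .inl h⟩

theorem map_label_children_insert (hn : n ∈ t.nodes) :
    (((Op.insert n u).apply t).children n).val.map ((Op.insert n u).apply t).label =
      u.label u.root ::ₘ (t.children n).val.map t.label := by
  rw [children_insert ht hu hd hn, Multiset.map_cons, label_insert_of_mem hu.root_mem]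
  congr 1
  exact Multiset.map_congr rfl fun c hc =>
    label_insert_of_notMem (Finset.disjoint_left.1 hd (mem_children.1 hc).1)

theorem IsTree.changedBelow_insert (hn : n ∈ t.nodes) :
    ChangedBelow t ((Op.insert n u).apply t) n fun _ => False where
  mem := hn
  mem' := mem_nodes_insert.2 (.inl hn)
  label := label_insert_of_notMem (Finset.disjoint_left.1 hd hn)
  root := rfl
  below _ h := h.elim
  parent _ _ _ h := h.elim
  frame _ hm hmn _ := ⟨mem_nodes_insert.2 (.inl hm), children_insert_of_ne ht hu hd hm hmn,
    key_insert_of_notMem (Finset.disjoint_left.1 hd hm)⟩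

omit ht hu in
/-- Insertion at `n` changes the content of `n` only, and the inserted tree conforms. -/
theorem ConformsOff.insert {D : DTD L} {R B : L} (ht : ConformsOff D R n t)
    (hu : Conforms D B u) (hn : n ∈ t.nodes) :
    ConformsOff D R n ((Op.insert n u).apply t) where
  isTree := ht.isTree.insert hu.isTree hd hn
  root_label := (label_insert_of_notMem (Finset.disjoint_left.1 hd ht.isTree.root_mem)).trans
    ht.root_label
  labels m hm := by
    by_cases hmu : m ∈ u.nodes
    · rw [label_insert_of_mem hmu]
      exact hu.labels m hmu
    · rw [label_insert_of_notMem hmu]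
      exact ht.labels m ((mem_nodes_insert.1 hm).resolve_right hmu)
  content m hm hmn C hC := by
    by_cases hmu : m ∈ u.nodes
    · rw [label_insert_of_mem hmu] at hC
      rw [children_insert_of_mem ht.isTree hu.isTree hd hn hmu]
      obtain ⟨w, hw, he⟩ := hu.content m hmu C hC
      refine ⟨w, hw, he.trans (Multiset.map_congr rfl fun c hc => ?_)⟩
      exact (label_insert_of_mem (mem_children.1 hc).1).symm
    · have hmt := (mem_nodes_insert.1 hm).resolve_right hmu
      rw [label_insert_of_notMem hmu] at hC
      rw [children_insert_of_ne ht.isTree hu.isTree hd hmt hmn]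
      obtain ⟨w, hw, he⟩ := ht.content m hmt hmn C hC
      refine ⟨w, hw, he.trans (Multiset.map_congr rfl fun c hc => ?_)⟩
      exact (label_insert_of_notMem (Finset.disjoint_left.1 hd (mem_children.1 hc).1)).symm
  text_leaf m hm hmn hs := by
    by_cases hmu : m ∈ u.nodes
    · rw [label_insert_of_mem hmu] at hs
      rw [children_insert_of_mem ht.isTree hu.isTree hd hn hmu]
      exact hu.text_leaf m hmu hs
    · have hmt := (mem_nodes_insert.1 hm).resolve_right hmu
      rw [label_insert_of_notMem hmu] at hs
      rw [children_insert_of_ne ht.isTree hu.isTree hd hmt hmn]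
      exact ht.text_leaf m hmt hmn hs

end Insert

/-- A replacement is a deletion followed by an insertion at the former parent. -/
theorem IsTree.replace_apply_eq {t : XMLTree L} (ht : t.IsTree) {p n : ℕ} (hp : t.Edge p n)
    (u : XMLTree L) :
    (Op.replace n u).apply t = (Op.insert p u).apply ((Op.delete n).apply t) := by
  have : (t.nodes.filter fun q => (q, n) ∈ t.edges) = {p} := by
    ext q
    rw [Finset.mem_filter, Finset.mem_singleton]
    constructor
    · rintro ⟨-, h⟩
      exact ht.parent_unique h hp
    · rintro rfl
      exact ⟨(ht.edges_mem _ _ hp).1, hp⟩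
  simp [Op.apply, this]

theorem ChangedBelow.trans_insert {t t' u : XMLTree L} {p : ℕ} {T : ℕ → Prop}
    (h : ChangedBelow t t' p T) (ht' : t'.IsTree) (hu : u.IsTree)
    (hd : Disjoint t'.nodes u.nodes) : ChangedBelow t ((Op.insert p u).apply t') p T where
  mem := h.mem
  mem' := mem_nodes_insert.2 (.inl h.mem')
  label := (label_insert_of_notMem (Finset.disjoint_left.1 hd h.mem')).trans h.label
  root := h.root
  below := h.below
  parent := h.parent
  frame m hm hmp hT := by
    obtain ⟨h1, h2, h3⟩ := h.frame m hm hmp hT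
    exact ⟨mem_nodes_insert.2 (.inl h1), (children_insert_of_ne ht' hu hd h1 hmp).trans h2,
      (key_insert_of_notMem (Finset.disjoint_left.1 hd h1)).trans h3⟩

theorem val_children_eq_cons_erase {t : XMLTree L} (ht : t.IsTree) {p n : ℕ} (hp : t.Edge p n) :
    (t.children p).val = n ::ₘ ((t.children p).erase n).val := by
  rw [Finset.erase_val, Multiset.cons_erase]
  exact mem_children.2 ⟨(ht.edges_mem _ _ hp).2, hp⟩

end

/-! ### Updates act on codes as steps -/

section Steps

open UTree

variable {L : Type*} {D : DTD L} {R : L} {t : XMLTree L} {S : Finset (UAT L)}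

theorem Conforms.insert_step (ht : Conforms D R t) {n : ℕ} {u : XMLTree L} {A B : L}
    (hn : n ∈ t.nodes) (hd : Disjoint t.nodes u.nodes) (hA : t.label n = .elem A)
    (hu : Conforms D B u) (hr : D.rg A = .star B) (hS : UAT.ins A B ∈ S) :
    Conforms D R ((Op.insert n u).apply t) ∧
      Step S (t.code t.root) (((Op.insert n u).apply t).code t.root) := by
  have hA' : ((Op.insert n u).apply t).label n = .elem A :=
    (label_insert_of_notMem (Finset.disjoint_left.1 hd hn)).trans hA
  have ht' : Conforms D R ((Op.insert n u).apply t) := by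
    refine ((ht.off n).insert hd hu hn).conforms hA' ?_
    rw [map_label_children_insert ht.isTree hu.isTree hd hn, hu.root_label]
    obtain ⟨w, hw, he⟩ := ht.content n hn A hA
    refine ⟨NodeLabel.elem B :: w, ?_, by rw [← he]; rfl⟩
    rw [hr] at hw ⊢
    intro x hx
    rcases List.mem_cons.1 hx with rfl | hx
    · rfl
    · exact hw x hx
  have hc := ht.isTree.changedBelow_insert hu.isTree hd hn
  refine ⟨ht', hc.step ht ht' ?_⟩
  rw [ht.code_of_elem hA, ht'.code_of_elem hA', children_insert ht.isTree hu.isTree hd hn,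
    Multiset.map_cons, Multiset.map_congr rfl fun c hc' =>
      hc.code_child_eq ht (mem_children.1 hc').2 not_false]
  exact .here _ _ _ (.ins B _ _ hS)

theorem Conforms.map_code_erase (ht : Conforms D R t) {t' : XMLTree L} {p n : ℕ}
    (hp : t.Edge p n) (hc : ChangedBelow t t' p (· ∈ t.desc n)) :
    ((t.children p).erase n).val.map t'.code = ((t.children p).erase n).val.map t.code := by
  refine Multiset.map_congr rfl fun c hc' => ?_
  obtain ⟨hne, hc'⟩ := Finset.mem_erase.1 hc'
  have he := (mem_children.1 hc').2
  exact hc.code_child_eq ht he (ht.isTree.notMem_desc_of_sibling hp he hne)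

theorem Conforms.delete_step (ht : Conforms D R t) {p n : ℕ} {A B : L} (hp : t.Edge p n)
    (hA : t.label p = .elem A) (hr : D.rg A = .star B) (hS : UAT.del A B ∈ S) :
    Conforms D R ((Op.delete n).apply t) ∧
      Step S (t.code t.root) (((Op.delete n).apply t).code t.root) := by
  have hpn := (ht.isTree.edges_mem _ _ hp).1
  have hcons := val_children_eq_cons_erase ht.isTree hp
  have ht' : Conforms D R ((Op.delete n).apply t) := by
    refine (ht.delete hp).conforms hA ?_
    obtain ⟨w, hw, he⟩ := ht.content p hpn A hA
    rw [ht.isTree.children_delete hp]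
    refine ⟨(((t.children p).erase n).val.map t.label).toList, ?_, Multiset.coe_toList _⟩
    rw [hr] at hw ⊢
    intro x hx
    refine hw x ?_
    rw [← Multiset.mem_coe, he, hcons, Multiset.map_cons]
    exact Multiset.mem_cons_of_mem (Multiset.mem_toList.1 hx)
  have hc := ht.isTree.changedBelow_delete hp
  refine ⟨ht', hc.step ht ht' ?_⟩
  rw [ht.code_of_elem hA, ht'.code_of_elem hA, ht.isTree.children_delete hp,
    ht.map_code_erase hp hc, hcons, Multiset.map_cons]
  exact .here _ _ _ (.del B _ _ hS)

theorem Conforms.replace_step (ht : Conforms D R t) {p n : ℕ} {u : XMLTree L} {A B B' : L}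
    {l : List L} (hd : Disjoint t.nodes u.nodes) (hp : t.Edge p n) (hA : t.label p = .elem A)
    (hB : t.label n = .elem B) (hu : Conforms D B' u) (hr : D.rg A = .alt l) (hB' : B' ∈ l)
    (hS : UAT.repl A B B' ∈ S) :
    Conforms D R ((Op.replace n u).apply t) ∧
      Step S (t.code t.root) (((Op.replace n u).apply t).code t.root) := by
  obtain ⟨hpn, hn⟩ := ht.isTree.edges_mem _ _ hp
  have hcons := val_children_eq_cons_erase ht.isTree hp
  rw [ht.isTree.replace_apply_eq hp]
  have hdel := ht.delete hp
  have hdel' : Disjoint ((Op.delete n).apply t).nodes u.nodes :=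
    Finset.disjoint_of_subset_left Finset.sdiff_subset hd
  have hc₀ := ht.isTree.changedBelow_delete hp
  have hA' : ((Op.insert p u).apply ((Op.delete n).apply t)).label p = .elem A :=
    (label_insert_of_notMem (Finset.disjoint_left.1 hd hpn)).trans hA
  have ht' : Conforms D R ((Op.insert p u).apply ((Op.delete n).apply t)) := by
    refine (hdel.insert hdel' hu hc₀.mem').conforms hA' ?_
    rw [map_label_children_insert hdel.isTree hu.isTree hdel' hc₀.mem', hu.root_label,
      ht.isTree.children_delete hp]
    obtain ⟨w, hw, he⟩ := ht.content p hpn A hA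
    rw [hr] at hw ⊢
    obtain ⟨b, -, rfl⟩ := hw
    rw [hcons, Multiset.map_cons] at he
    have h0 : (((t.children p).erase n).val.map t.label) = 0 := by
      simpa using congrArg Multiset.card he
    have h0' : ((t.children p).erase n).val = 0 := Multiset.map_eq_zero.1 h0
    exact ⟨[.elem B'], ⟨B', hB', rfl⟩, by rw [h0']; rfl⟩
  have hc := hc₀.trans_insert hdel.isTree hu.isTree hdel'
  refine ⟨ht', hc.step ht ht' ?_⟩
  rw [ht.code_of_elem hA, ht'.code_of_elem hA',
    children_insert hdel.isTree hu.isTree hdel' hc₀.mem', ht.isTree.children_delete hp,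
    Multiset.map_cons, ht.map_code_erase hp hc, hcons, Multiset.map_cons]
  refine .here _ _ _ (.repl _ _ _ B B' ?_ ?_ hS)
  · rw [ht.label_code hn, hB]
  · rw [ht'.label_code (mem_nodes_insert.2 (.inr hu.isTree.root_mem)),
      label_insert_of_mem hu.isTree.root_mem, hu.root_label]

theorem Conforms.replaceText_step (ht : Conforms D R t) {p n : ℕ} {s : String} {A : L}
    (hp : t.Edge p n) (hA : t.label p = .elem A) (hs : t.label n = .str) (hr : D.rg A = .text)
    (hS : UAT.replStr A ∈ S) :
    Conforms D R ((Op.replaceText n s).apply t) ∧ ((Op.replaceText n s).apply t = t ∨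
      Step S (t.code t.root) (((Op.replaceText n s).apply t).code t.root)) := by
  obtain ⟨hpn, hn⟩ := ht.isTree.edges_mem _ _ hp
  have htr : ((Op.replaceText n s).apply t).IsTree :=
    ⟨ht.isTree.root_mem, ht.isTree.edges_mem, ht.isTree.root_no_parent, ht.isTree.unique_parent,
      ht.isTree.reachable⟩
  have ht' : Conforms D R ((Op.replaceText n s).apply t) :=
    ⟨htr, ht.root_label, ht.labels, ht.content, ht.text_leaf⟩
  refine ⟨ht', ?_⟩
  by_cases hv : t.val n = s
  · left
    simp [Op.apply, ← hv]
  · right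
    have hpne : p ≠ n := by
      rintro rfl
      simp [hA] at hs
    -- Only the text node itself is affected, a child of `p`.
    have hc : ChangedBelow t ((Op.replaceText n s).apply t) p (· = n) :=
      { mem := hpn
        mem' := hpn
        label := rfl
        root := rfl
        below := by rintro _ rfl; exact .single hp
        parent := by rintro m _ hm rfl; exact .inl (ht.isTree.parent_unique hm hp)
        frame := fun m hm _ hmn => ⟨hm, rfl, key_congr rfl fun _ => by
          simp [Op.apply, Function.update_of_ne hmn]⟩ }
    refine hc.step ht ht' ?_
    have hcons := val_children_eq_cons_erase ht.isTree hp
    have h0 : ((t.children p).erase n).val = 0 := by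
      obtain ⟨w, hw, he⟩ := ht.content p hpn A hA
      rw [hr] at hw
      rw [Set.mem_singleton_iff.1 hw, hcons] at he
      simpa using congrArg Multiset.card he
    rw [h0] at hcons
    have hcons' : (((Op.replaceText n s).apply t).children p).val = n ::ₘ 0 := hcons
    have hs' : ((Op.replaceText n s).apply t).label n = .str := hs
    rw [ht.code_of_elem hA, ht'.code_of_elem hA, hcons, hcons', Multiset.map_cons,
      Multiset.map_cons, ht.code_of_str hn hs, ht'.code_of_str hn hs']
    refine .here _ _ _ (.text _ _ _ hS ?_)
    simpa [Op.apply] using hv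

end Steps

end XMLTree

/-! ### Local conditions and consistency -/

section Consistency

open XMLTree

variable {L : Type*} [DecidableEq L] {D : DTD L} {R : L} {S : Finset (UAT L)}

/-- Updates preserve conformance and act on codes as steps, except for the replacement of a string
by itself, which does not change the tree. -/
theorem OpIn.step (hS : S ⊆ D.valid) {t : XMLTree L} (ht : Conforms D R t) {op : Op L}
    (h : OpIn D S t op) : Conforms D R (op.apply t) ∧
      (op.apply t = t ∨ Step S (t.code t.root) ((op.apply t).code (op.apply t).root)) := by
  obtain ⟨hv, u, hu, hm⟩ := h
  cases op <;> cases u <;> simp only [Op.Matches] at hm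
  · exact (ht.insert_step hv.1 hv.2 hm.1 hm.2 (DTD.ins_mem_valid.1 (hS hu)).2 hu).imp id .inr
  · obtain ⟨-, p, hp, hA⟩ := hm
    exact (ht.delete_step hp hA (DTD.del_mem_valid.1 (hS hu)).2 hu).imp id .inr
  · obtain ⟨hB, hu', ⟨p, hp, hA⟩, -⟩ := hm
    obtain ⟨-, l, hr, -, hl, -⟩ := DTD.repl_mem_valid.1 (hS hu)
    exact (ht.replace_step hv.2 hp hA hB hu' hr hl hu).imp id .inr
  · obtain ⟨hs, p, hp, hA⟩ := hm
    exact ht.replaceText_step hp hA hs (DTD.replStr_mem_valid.1 (hS hu)).2 hu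

theorem Simulates.reach (hS : S ⊆ D.valid) {t t' : XMLTree L} (h : Simulates D S t t')
    (ht : Conforms D R t) :
    Conforms D R t' ∧ Reach D S (t.code t.root) (t'.code t'.root) := by
  induction h with
  | nil => exact ⟨ht, .refl⟩
  | cons t t' op hop _ ih =>
    obtain ⟨ht₁, h₁⟩ := hop.step hS ht
    refine (ih ht₁).imp id fun hr => ?_
    rcases h₁ with h₁ | h₁
    · rwa [h₁] at hr
    · exact .head ⟨ht.inst_code ht.isTree.root_mem, ht₁.inst_code ht₁.isTree.root_mem, h₁⟩ hr

theorem LocallyConsistent.consistent {P : Policy D}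
    (h : LocallyConsistent D P.allowed P.forbidden) : P.Consistent := by
  intro t ht op₀ hop hne t' hsim hiso
  obtain ⟨ht₀, h₀⟩ := hop.step h.subset' ht
  obtain ⟨ht', hr⟩ := hsim.reach h.subset ht
  rcases h₀ with h₀ | h₀
  · rw [h₀] at hne
    exact hne (Iso.refl t)
  · rw [← hiso.code_eq ht'] at hr
    refine h.not_reach h₀ (ht.inst_code ht.isTree.root_mem) (ht₀.inst_code ht₀.isTree.root_mem)
      (A := D.root) ?_ .refl hr
    rw [ht.label_code ht.isTree.root_mem, ht.root_label]

end Consistency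

/-! ### Relations that are transitive off the diagonal -/

/-- The transitive closure of such a relation adds only loops, and these come from cycles of length
two. -/
theorem transGen_of_trans_of_ne {α : Type*} {E : α → α → Prop}
    (hE : ∀ x y z, E x y → E y z → x ≠ z → E x z) {x z : α} (h : Relation.TransGen E x z) :
    E x z ∨ x = z ∧ ∃ y, E x y ∧ E y x := by
  induction h with
  | single h => exact .inl h
  | @tail y z _ hyz ih =>
    by_cases hxz : x = z
    · subst hxz
      rcases ih with h | ⟨rfl, w, hw⟩
      · exact .inr ⟨rfl, y, h, hyz⟩
      · exact .inr ⟨rfl, w, hw⟩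
    · rcases ih with h | ⟨rfl, -⟩
      · exact .inl (hE x y z h hyz hxz)
      · exact .inl hyz

section Algorithms

variable {L : Type*} [DecidableEq L]

/-! ### The naive algorithm -/

section Naive

variable {V : List L} {G : Finset (L × L)} {neg : L → Prop}
  {pick : Finset (L × L) → L → L → L → Bool}

/-- The condition under which the naive algorithm deletes one of the edges `(X, Y)`, `(Y, Z)` of
`G \ C`. -/
def Violation (G : Finset (L × L)) (neg : L → Prop) (C : Finset (L × L)) (X Y Z : L) : Prop :=
  ((X, Y) ∈ G \ C ∧ (Y, Z) ∈ G \ C) ∧ ((X ≠ Z ∧ (X, Z) ∉ G \ C) ∨ (X = Z ∧ neg X))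

/-- Deleting the edge `e` creates violations only at vertices that are reachable from the source
of `e`. -/
theorem Violation.of_insert {C : Finset (L × L)} {e : L × L} {X Y Z : L}
    (h : Violation G neg (insert e C) X Y Z) :
    (X, Y) ≠ e ∧ (Y, Z) ≠ e ∧
      (Violation G neg C X Y Z ∨ Relation.ReflTransGen (fun x y => (x, y) ∈ G) e.1 Y) := by
  obtain ⟨⟨h1, h2⟩, h3⟩ := h
  simp only [Finset.mem_sdiff, Finset.mem_insert, not_or] at h1 h2 h3
  refine ⟨h1.2.1, h2.2.1, ?_⟩
  by_cases he : (X, Z) = e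
  · subst he
    exact .inr (.single h1.1)
  · left
    refine ⟨⟨Finset.mem_sdiff.2 ⟨h1.1, h1.2.2⟩, Finset.mem_sdiff.2 ⟨h2.1, h2.2.2⟩⟩, ?_⟩
    refine h3.imp (fun h => ⟨h.1, fun hm => ?_⟩) id
    exact h.2 ⟨(Finset.mem_sdiff.1 hm).1, he, (Finset.mem_sdiff.1 hm).2⟩

/-- The invariant of the inner loops for the vertex `B`, in which the pairs that satisfy `Q` have
been treated: violations are left only at vertices on the stack and at `B` for the remaining
pairs. -/
def ScanInv (V : List L) (G : Finset (L × L)) (neg : L → Prop) (B : L) (Q : L × L → Prop)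
    (s : List L × Finset (L × L)) : Prop :=
  ∀ Y ∈ V, Y ∉ s.1 → ∀ X Z, (Y = B → Q (X, Z)) → ¬ Violation G neg s.2 X Y Z

theorem naiveStep_of_violation {B : L} {s : List L × Finset (L × L)} {p : L × L}
    (h : Violation G neg s.2 p.1 B p.2) : ∃ e, (e = (p.1, B) ∨ e = (B, p.2)) ∧
      (naiveStep V G neg pick B s p).2 = insert e s.2 ∧
      ∀ Y, Y ∈ (naiveStep V G neg pick B s p).1 ↔
        (Y ∈ V ∧ Relation.ReflTransGen (fun x y => (x, y) ∈ G) e.1 Y) ∨ Y ∈ s.1 := by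
  refine ⟨if pick s.2 p.1 B p.2 then (p.1, B) else (B, p.2), by split <;> simp, ?_⟩
  rw [show naiveStep V G neg pick B s p = _ from if_pos h]
  simp

theorem naiveStep_of_not_violation {B : L} {s : List L × Finset (L × L)} {p : L × L}
    (h : ¬ Violation G neg s.2 p.1 B p.2) : naiveStep V G neg pick B s p = s :=
  if_neg h

theorem ScanInv.step {B : L} {Q : L × L → Prop} {s : List L × Finset (L × L)}
    (h : ScanInv V G neg B Q s) (p : L × L) :
    ScanInv V G neg B (fun q => Q q ∨ q = p) (naiveStep V G neg pick B s p) := by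
  intro Y hY hYs X Z hQ
  by_cases hv : Violation G neg s.2 p.1 B p.2
  · obtain ⟨e, he, h2, h1⟩ := naiveStep_of_violation (V := V) (pick := pick) hv
    rw [h1, not_or] at hYs
    rw [h2]
    intro hv'
    obtain ⟨hne, hne', hv' | hr⟩ := hv'.of_insert
    · refine h Y hY hYs.2 X Z (fun hYB => (hQ hYB).resolve_right ?_) hv'
      rintro rfl
      subst hYB
      exact he.elim (fun h => hne h.symm) fun h => hne' h.symm
    · exact hYs.1 ⟨hY, hr⟩
  · rw [naiveStep_of_not_violation hv] at hYs ⊢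
    by_cases hp : Y = B ∧ (X, Z) = p
    · obtain ⟨rfl, rfl⟩ := hp
      exact hv
    · exact h Y hY hYs X Z fun hYB => (hQ hYB).resolve_right fun h => hp ⟨hYB, h⟩

theorem ScanInv.foldl {B : L} {Q : L × L → Prop} {s : List L × Finset (L × L)}
    (h : ScanInv V G neg B Q s) (l : List (L × L)) :
    ScanInv V G neg B (fun q => Q q ∨ q ∈ l) (l.foldl (naiveStep V G neg pick B) s) := by
  induction l generalizing Q s with
  | nil => simpa using h
  | cons p l ih =>
    have := ih (h.step (pick := pick) p)
    simpa only [List.mem_cons, List.foldl_cons, or_assoc] using this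

/-- When the naive algorithm stops, there is no violation. -/
theorem naiveLoop_spec (hG : ∀ e ∈ G, e.1 ∈ V ∧ e.2 ∈ V) (stack : List L) (C : Finset (L × L))
    (h : ∀ Y ∈ V, Y ∉ stack → ∀ X Z, ¬ Violation G neg C X Y Z) :
    ∀ X Y Z, ¬ Violation G neg (naiveLoop V G neg pick stack C) X Y Z := by
  induction stack, C using naiveLoop.induct (V := V) (G := G) (neg := neg) (pick := pick) with
  | case1 C =>
    intro X Y Z hv
    rw [naiveLoop] at hv
    exact h Y (hG _ (Finset.mem_sdiff.1 hv.1.1).1).2 (by simp) X Z hv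
  | case2 C B S ih =>
    rw [naiveLoop]
    apply ih
    have h0 : ScanInv V G neg B (fun _ => False) (S, C) := by
      intro Y hY hYS X Z hYB
      refine h Y hY ?_ X Z
      rw [List.mem_cons, not_or]
      exact ⟨hYB, hYS⟩
    intro Y hY hYs X Z hv
    refine h0.foldl (pick := pick) (V.product V) Y hY hYs X Z (fun _ => .inr ?_) hv
    exact List.mem_product.2 ⟨(hG _ (Finset.mem_sdiff.1 hv.1.1).1).1,
      (hG _ (Finset.mem_sdiff.1 hv.1.2).1).2⟩

/-- The naive algorithm deletes nothing from a graph without violations. -/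
theorem naiveLoop_eq_self {C : Finset (L × L)} (h : ∀ X Y Z, ¬ Violation G neg C X Y Z)
    (stack : List L) : naiveLoop V G neg pick stack C = C := by
  have hs : ∀ B S, naiveScan V G neg pick B (S, C) = (S, C) := by
    intro B S
    unfold naiveScan
    induction V.product V with
    | nil => rfl
    | cons p l ih =>
      rw [List.foldl_cons]
      have : naiveStep V G neg pick B (S, C) p = (S, C) := if_neg (h p.1 B p.2)
      rw [this, ih]
  induction stack with
  | nil => rw [naiveLoop]
  | cons B S ih => rw [naiveLoop, hs, ih]

end Naive

/-! ### The set cover algorithm -/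

section SetCover

variable {mnj : ℕ} {V : List L} {G : Finset (L × L)} {neg : L → Prop}

theorem addJustifications_ne_nil {J₁ J₂ J : List (Finset (L × L))}
    (h : J ≠ [] ∨ (0 < mnj ∧ J₁ ≠ [] ∧ J₂ ≠ [])) : addJustifications mnj J₁ J₂ J ≠ [] := by
  unfold addJustifications
  have hstep : ∀ (J : List (Finset (L × L))) (p : Finset (L × L) × Finset (L × L)),
      (J ≠ [] ∨ 0 < mnj) →
      (if J.length < mnj then J.insert (p.1 ∪ p.2) else J) ≠ [] := by
    intro J p hJ
    split_ifs with hl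
    · exact List.ne_nil_of_mem List.mem_insert_self
    · rcases hJ with hJ | hJ
      · exact hJ
      · rintro rfl
        exact hl hJ
  have hfold : ∀ (l : List (Finset (L × L) × Finset (L × L))) (J : List (Finset (L × L))),
      J ≠ [] → l.foldl (fun J p => if J.length < mnj then J.insert (p.1 ∪ p.2) else J) J ≠ [] := by
    intro l
    induction l with
    | nil => exact fun J hJ => hJ
    | cons p l ih => exact fun J hJ => ih _ (hstep J p (.inl hJ))
  rcases h with h | ⟨hm, h1, h2⟩
  · exact hfold _ _ h
  · obtain ⟨a, J₁, rfl⟩ := List.exists_cons_of_ne_nil h1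
    obtain ⟨b, J₂, rfl⟩ := List.exists_cons_of_ne_nil h2
    have hab : (a, b) ∈ (a :: J₁).product (b :: J₂) :=
      List.mem_product.2 ⟨List.mem_cons_self, List.mem_cons_self⟩
    obtain ⟨p, l, hl⟩ := List.exists_cons_of_ne_nil (List.ne_nil_of_mem hab)
    rw [hl, List.foldl_cons]
    exact hfold _ _ (hstep J p (.inr hm))

theorem mem_addJustifications {J₁ J₂ J : List (Finset (L × L))} {j : Finset (L × L)}
    (h : j ∈ addJustifications mnj J₁ J₂ J) : j ∈ J ∨ ∃ a ∈ J₁, ∃ b ∈ J₂, j = a ∪ b := by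
  unfold addJustifications at h
  have hsub : ∀ p ∈ J₁.product J₂, p.1 ∈ J₁ ∧ p.2 ∈ J₂ := fun p hp => List.mem_product.1 hp
  generalize J₁.product J₂ = l at h hsub
  induction l generalizing J with
  | nil => exact .inl h
  | cons p l ih =>
    rw [List.foldl_cons] at h
    rcases ih h fun q hq => hsub q (List.mem_cons_of_mem _ hq) with h | h
    · split_ifs at h
      · rcases List.mem_insert_iff.1 h with h | h
        · obtain ⟨h1, h2⟩ := hsub p List.mem_cons_self
          exact .inr ⟨_, h1, _, h2, h⟩
        · exact .inl h
      · exact .inl h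
    · exact .inr h

/-- Well-formed states of the computation of justifications: every edge has a justification, and
every justification contains an edge of the replace graph; vertices have justifications only if they
are marked. -/
structure JState.Good (V : List L) (G : Finset (L × L)) (neg : L → Prop) (s : JState L) : Prop where
  edgeJ_ne : ∀ e ∈ G ∪ s.derived, s.edgeJ e ≠ []
  edgeJ_mem : ∀ e, ∀ j ∈ s.edgeJ e, ∃ e' ∈ G, e' ∈ j
  vertJ_mem : ∀ v, ∀ j ∈ s.vertJ v, (∃ e' ∈ G, e' ∈ j) ∧ neg v
  derived : ∀ e ∈ s.derived, e.1 ∈ V ∧ e.2 ∈ V ∧ e.1 ≠ e.2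

theorem JState.Good.step (hmnj : 0 < mnj) {s : JState L} (h : s.Good V G neg) (q : L × L × L)
    (hq : q.2.1 ∈ V ∧ q.2.2 ∈ V) : (justStep mnj G neg s q).Good V G neg := by
  obtain ⟨B, A, Z⟩ := q
  have hJ : ∀ {J₁ J₂ J : List (Finset (L × L))}, (∀ j ∈ J₁, ∃ e' ∈ G, e' ∈ j) →
      (∀ j ∈ J, ∃ e' ∈ G, e' ∈ j) → ∀ j ∈ addJustifications mnj J₁ J₂ J, ∃ e' ∈ G, e' ∈ j := by
    intro J₁ J₂ J h1 h2 j hj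
    rcases mem_addJustifications hj with hj | ⟨a, ha, b, -, rfl⟩
    · exact h2 j hj
    · obtain ⟨e', he', hm⟩ := h1 a ha
      exact ⟨e', he', Finset.mem_union_left _ hm⟩
  unfold justStep
  dsimp only
  split_ifs with h1 h2 h3
  · refine ⟨?_, ?_, h.vertJ_mem, ?_⟩
    · intro e he
      by_cases hAZ : e = (A, Z)
      · subst hAZ
        simp only [Function.update_self]
        exact addJustifications_ne_nil (.inr ⟨hmnj, h.edgeJ_ne _ h1.1, h.edgeJ_ne _ h1.2⟩)
      · simp only [Function.update_of_ne hAZ]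
        refine h.edgeJ_ne e ?_
        simp only [Finset.mem_union, Finset.mem_insert, hAZ, false_or] at he ⊢
        exact he
    · intro e
      by_cases hAZ : e = (A, Z)
      · subst hAZ
        simp only [Function.update_self]
        exact hJ (h.edgeJ_mem _) (h.edgeJ_mem _)
      · simp only [Function.update_of_ne hAZ]
        exact h.edgeJ_mem e
    · intro e he
      rcases Finset.mem_insert.1 he with rfl | he
      · exact ⟨hq.1, hq.2, h2.1⟩
      · exact h.derived e he
  · refine ⟨h.edgeJ_ne, h.edgeJ_mem, ?_, h.derived⟩
    intro v
    by_cases hv : v = A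
    · subst hv
      simp only [Function.update_self]
      exact fun j hj => ⟨hJ (h.edgeJ_mem _) (fun j hj => (h.vertJ_mem _ j hj).1) j hj, h3.2⟩
    · simp only [Function.update_of_ne hv]
      exact h.vertJ_mem v
  · exact h
  · exact h

/-- The edges of the replace graph and those constructed so far. -/
def JState.edge (G : Finset (L × L)) (s : JState L) (x y : L) : Prop := (x, y) ∈ G ∪ s.derived

/-- The states `s'` that can follow the state `s` in a run. -/
def JState.Grows (s s' : JState L) : Prop :=
  s.derived ⊆ s'.derived ∧ ∀ v, s.vertJ v ≠ [] → s'.vertJ v ≠ []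

theorem JState.Grows.edge {s s' : JState L} (h : s.Grows s') {x y : L} (hxy : s.edge G x y) :
    s'.edge G x y :=
  Finset.union_subset_union_right h.1 hxy

/-- The entry `(X, Z)` is up to date with respect to the intermediate vertex `B`. -/
def JState.Closed (G : Finset (L × L)) (neg : L → Prop) (s : JState L) (B X Z : L) : Prop :=
  s.edge G X B → s.edge G B Z → (X ≠ Z → s.edge G X Z) ∧ (X = Z → neg X → s.vertJ X ≠ [])

theorem justStep_grows (s : JState L) (q : L × L × L) : s.Grows (justStep mnj G neg s q) := by
  unfold justStep
  dsimp only
  split_ifs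
  · exact ⟨Finset.subset_insert _ _, fun _ h => h⟩
  · refine ⟨subset_rfl, fun v hv => ?_⟩
    by_cases hvA : v = q.2.1
    · subst hvA
      simp only [Function.update_self]
      exact addJustifications_ne_nil (.inl hv)
    · simpa only [Function.update_of_ne hvA] using hv
  · exact ⟨subset_rfl, fun _ h => h⟩
  · exact ⟨subset_rfl, fun _ h => h⟩

theorem justStep_edge {s : JState L} {B A Z x y : L}
    (h : (justStep mnj G neg s (B, A, Z)).edge G x y) :
    s.edge G x y ∨ (x ≠ y ∧ s.edge G x B ∧ s.edge G B y) := by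
  unfold justStep at h
  dsimp only at h
  split_ifs at h with h1 h2
  · simp only [JState.edge, Finset.mem_union, Finset.mem_insert] at h
    rcases h with h | h | h
    · exact .inl (Finset.mem_union_left _ h)
    · obtain ⟨rfl, rfl⟩ := Prod.mk.injEq _ _ _ _ ▸ h
      exact .inr ⟨h2.1, h1⟩
    · exact .inl (Finset.mem_union_right _ h)
  · exact .inl h
  · exact .inl h
  · exact .inl h

theorem justStep_spec (hmnj : 0 < mnj) {s : JState L} (hs : s.Good V G neg) {B A Z : L}
    (h1 : s.edge G A B) (h2 : s.edge G B Z) :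
    (A ≠ Z → (justStep mnj G neg s (B, A, Z)).edge G A Z) ∧
      (A = Z → neg A → (justStep mnj G neg s (B, A, Z)).vertJ A ≠ []) := by
  unfold justStep
  dsimp only
  rw [if_pos ⟨h1, h2⟩]
  constructor
  · intro hne
    by_cases hG : (A, Z) ∈ G
    · exact Finset.mem_union_left _ hG
    · rw [if_pos ⟨hne, hG⟩]
      exact Finset.mem_union_right _ (Finset.mem_insert_self _ _)
  · rintro rfl hneg
    rw [if_neg (by simp), if_pos ⟨rfl, hneg⟩]
    simp only [Function.update_self]
    exact addJustifications_ne_nil (.inr ⟨hmnj, hs.edgeJ_ne _ h1, hs.edgeJ_ne _ h2⟩)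

/-- One phase of the Floyd-Warshall algorithm, for the intermediate vertex `B`: new edges are
compositions of two old edges at `B`, and all these compositions are treated. -/
theorem phase_spec (hmnj : 0 < mnj) (hG : ∀ e ∈ G, e.1 ≠ e.2) {s₀ : JState L}
    (hs₀ : s₀.Good V G neg) (B : L) (l : List (L × L)) (hl : ∀ p ∈ l, p.1 ∈ V ∧ p.2 ∈ V) :
    ∃ s, s = (l.map (B, ·)).foldl (justStep mnj G neg) s₀ ∧ s.Good V G neg ∧ s₀.Grows s ∧
      (∀ x y, s.edge G x y → s₀.edge G x y ∨ (x ≠ y ∧ s₀.edge G x B ∧ s₀.edge G B y)) ∧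
      ∀ p ∈ l, s₀.edge G p.1 B → s₀.edge G B p.2 →
        (p.1 ≠ p.2 → s.edge G p.1 p.2) ∧ (p.1 = p.2 → neg p.1 → s.vertJ p.1 ≠ []) := by
  have hBB : ¬ s₀.edge G B B := by
    intro h
    rcases Finset.mem_union.1 h with h | h
    · exact hG _ h rfl
    · exact (hs₀.derived _ h).2.2 rfl
  induction l using List.reverseRecOn with
  | nil => exact ⟨s₀, rfl, hs₀, ⟨subset_rfl, fun _ h => h⟩, fun _ _ h => .inl h, by simp⟩
  | append_singleton l p ih =>
    obtain ⟨s, hs, hgood, hgrow, hedge, hdone⟩ := ih fun q hq => hl q (by simp [hq])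
    obtain ⟨A, Z⟩ := p
    have hg := justStep_grows (mnj := mnj) (G := G) (neg := neg) s (B, A, Z)
    refine ⟨justStep mnj G neg s (B, A, Z), by simp [hs],
      hgood.step hmnj _ (hl (A, Z) (by simp)),
      ⟨hgrow.1.trans hg.1, fun v h => hg.2 v (hgrow.2 v h)⟩,
      ?_, ?_⟩
    · intro x y h
      -- Composition with new edges at `B` yields nothing new, as there is no loop at `B`.
      rcases justStep_edge h with h | ⟨hne, h1, h2⟩
      · exact hedge x y h
      · exact .inr ⟨hne, (hedge _ _ h1).elim id fun h => h.2.1,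
          (hedge _ _ h2).elim id fun h => h.2.2⟩
    · intro q hq h1 h2
      rw [List.mem_append, List.mem_singleton] at hq
      rcases hq with hq | rfl
      · obtain ⟨h3, h4⟩ := hdone q hq h1 h2
        exact ⟨fun h => hg.edge (h3 h), fun h h' => hg.2 _ (h4 h h')⟩
      · exact justStep_spec hmnj hgood (hgrow.edge h1) (hgrow.edge h2)

/-- The Floyd-Warshall algorithm closes the replace graph under composition off the diagonal, and
finds all marked vertices on cycles. -/
theorem computeJustifications_spec (hmnj : 0 < mnj)
    (hG : ∀ e ∈ G, e.1 ∈ V ∧ e.2 ∈ V ∧ e.1 ≠ e.2) :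
    (computeJustifications mnj V G neg).Good V G neg ∧
      ∀ B X Z, (computeJustifications mnj V G neg).Closed G neg B X Z := by
  set s₀ : JState L :=
    { derived := ∅, edgeJ := fun e => if e ∈ G then [{e}] else [], vertJ := fun _ => [] } with hs₀
  have hgood₀ : s₀.Good V G neg := by
    refine ⟨?_, ?_, by simp [hs₀], by simp [hs₀]⟩
    · intro e he
      have : e ∈ G := by simpa [hs₀] using he
      simp [hs₀, this]
    · intro e j hj
      simp only [hs₀] at hj
      split_ifs at hj with he
      · rw [List.mem_singleton] at hj
        exact ⟨e, he, by simp [hj]⟩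
      · simp at hj
  have hV : ∀ s : JState L, s.Good V G neg → ∀ x y, s.edge G x y → x ∈ V ∧ y ∈ V ∧ x ≠ y := by
    intro s hs x y h
    rcases Finset.mem_union.1 h with h | h
    · exact hG _ h
    · exact hs.derived _ h
  have main : ∀ l : List L, ∃ s,
      s = (l.flatMap fun B => (V.product V).map (B, ·)).foldl (justStep mnj G neg) s₀ ∧
      s.Good V G neg ∧ ∀ B ∈ l, ∀ X Z, s.Closed G neg B X Z := by
    intro l
    induction l using List.reverseRecOn with
    | nil => exact ⟨s₀, rfl, hgood₀, by simp⟩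
    | append_singleton l B ih =>
      obtain ⟨s, hs, hgood, hcl⟩ := ih
      obtain ⟨s', hs', hgood', hgrow, hedge, hdone⟩ := phase_spec hmnj (fun e he => (hG e he).2.2)
        hgood B (V.product V) fun p hp => List.mem_product.1 hp
      have hBB : ¬ s.edge G B B := fun h => (hV s hgood _ _ h).2.2 rfl
      -- Whatever can be composed at `B` in the old state is up to date in the new one.
      have hB : ∀ X Z, s.edge G X B → s.edge G B Z →
          (X ≠ Z → s'.edge G X Z) ∧ (X = Z → neg X → s'.vertJ X ≠ []) := fun X Z h1 h2 =>
        hdone (X, Z) (List.mem_product.2 ⟨(hV s hgood _ _ h1).1, (hV s hgood _ _ h2).2.1⟩) h1 h2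
      refine ⟨s', by rw [hs', hs, List.flatMap_append, List.foldl_append]; simp, hgood', ?_⟩
      intro C hC X Z h1 h2
      have hXB : s'.edge G X B → s.edge G X B := fun h => (hedge _ _ h).elim id fun h => h.2.1
      have hBZ : s'.edge G B Z → s.edge G B Z := fun h => (hedge _ _ h).elim id fun h => h.2.2
      rw [List.mem_append, List.mem_singleton] at hC
      rcases hC with hC | rfl
      · rcases hedge _ _ h1 with h1 | ⟨-, h1, h1'⟩ <;> rcases hedge _ _ h2 with h2 | ⟨-, h2, h2'⟩
        · obtain ⟨h3, h4⟩ := hcl C hC X Z h1 h2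
          exact ⟨fun h => hgrow.edge (h3 h), fun h h' => hgrow.2 _ (h4 h h')⟩
        · by_cases hX : X = B
          · subst hX
            exact ⟨fun _ => hgrow.edge h2', fun h => absurd (h ▸ h2') hBB⟩
          · exact hB X Z ((hcl C hC X B h1 h2).1 hX) h2'
        · by_cases hZ : B = Z
          · subst hZ
            exact ⟨fun _ => hgrow.edge h1, fun h => absurd (h ▸ h1) hBB⟩
          · exact hB X Z h1 ((hcl C hC B Z h1' h2).1 hZ)
        · exact hB X Z h1 h2'
      · exact hB X Z (hXB h1) (hBZ h2)
  obtain ⟨s, hs, hgood, hcl⟩ := main V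
  have heq : computeJustifications mnj V G neg = s := by
    rw [hs]
    rfl
  rw [heq]
  refine ⟨hgood, fun B X Z h1 => hcl B (hV s hgood _ _ h1).2.1 X Z h1⟩

/-- If the universe of the set cover instance is empty, then the transitive closure of the replace
graph contains no forbidden edge and no loop at a marked vertex. -/
theorem not_transGen_of_coverUniverse_eq_empty (hmnj : 0 < mnj)
    (hG : ∀ e ∈ G, e.1 ∈ V ∧ e.2 ∈ V ∧ e.1 ≠ e.2) {F : Finset (L × L)}
    (hU : coverUniverse V F (computeJustifications mnj V G neg) = ∅) {X Y : L}
    (h : Relation.TransGen (fun x y => (x, y) ∈ G) X Y) :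
    (X ≠ Y → (X, Y) ∉ F) ∧ (X = Y → ¬ neg X) := by
  obtain ⟨hgood, hcl⟩ := computeJustifications_spec (neg := neg) hmnj hG
  set s := computeJustifications mnj V G neg with hs
  have hU' : ∀ j, j ∉ coverUniverse V F s := by simp [hU]
  simp only [coverUniverse, Finset.mem_union, Finset.mem_biUnion, List.mem_toFinset, not_or,
    not_exists, not_and] at hU'
  have hE := transGen_of_trans_of_ne (E := s.edge G) (fun x y z h1 h2 => (hcl y x z h1 h2).1)
    (h.lift id fun _ _ h => Finset.mem_union_left _ h)
  have hV : ∀ x y, s.edge G x y → x ∈ V ∧ y ∈ V ∧ x ≠ y := by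
    intro x y h
    rcases Finset.mem_union.1 h with h | h
    · exact hG _ h
    · exact hgood.derived _ h
  constructor
  · intro hne hF
    have hXY := hE.resolve_right fun h => hne h.1
    obtain ⟨j, hj⟩ := List.exists_mem_of_ne_nil _ (hgood.edgeJ_ne _ hXY)
    exact (hU' j).1 _ hF hj
  · rintro rfl hneg
    rcases hE with hE | ⟨-, y, h1, h2⟩
    · exact (hV _ _ hE).2.2 rfl
    · obtain ⟨j, hj⟩ := List.exists_mem_of_ne_nil _ ((hcl y X X h1 h2).2 rfl hneg)
      exact (hU' j).2 X (hV _ _ h1).1 hj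

/-- When the set cover algorithm stops, the transitive closure of the remaining graph contains no
edge that was forbidden or has been deleted, and no loop at a marked vertex. -/
theorem setCoverLoop_spec (sc : SetCoverAlg (L × L)) (hmnj : 0 < mnj) {F G₀ : Finset (L × L)}
    (hG₀ : ∀ e ∈ G₀, e.1 ∈ V ∧ e.2 ∈ V ∧ e.1 ≠ e.2) (G C : Finset (L × L)) (hGC : G = G₀ \ C)
    {X Y : L} (h : Relation.TransGen
      (fun x y => (x, y) ∈ G₀ \ setCoverLoop sc mnj V F neg G C) X Y) :
    (X ≠ Y → (X, Y) ∉ F ∪ setCoverLoop sc mnj V F neg G C) ∧ (X = Y → ¬ neg X) := by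
  induction G, C using setCoverLoop.induct (sc := sc) (mnj := mnj) (V := V) (F := F)
    (neg := neg) with
  | case1 G C sce hsce =>
    have heq : setCoverLoop sc mnj V F neg G C = C := by
      rw [setCoverLoop]
      exact if_pos hsce
    rw [heq] at h ⊢
    rw [← hGC] at h
    have hG : ∀ e ∈ G, e.1 ∈ V ∧ e.2 ∈ V ∧ e.1 ≠ e.2 := by
      intro e he
      rw [hGC] at he
      exact hG₀ e (Finset.mem_sdiff.1 he).1
    refine not_transGen_of_coverUniverse_eq_empty hmnj hG ?_ h
    have hgood := (computeJustifications_spec (neg := neg) hmnj hG).1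
    -- Every justification can be covered: if nothing is selected, then there is nothing to cover.
    rw [Finset.eq_empty_iff_forall_notMem]
    intro j hj
    have hcov : ∀ j ∈ coverUniverse V (F ∪ C) (computeJustifications mnj V G neg),
        ∃ e ∈ G, e ∈ j := by
      intro j hj
      simp only [coverUniverse, Finset.mem_union, Finset.mem_biUnion, List.mem_toFinset] at hj
      rcases hj with ⟨e, -, hj⟩ | ⟨v, -, hj⟩
      · exact hgood.edgeJ_mem e j hj
      · exact (hgood.vertJ_mem v j hj).1
    obtain ⟨e, he, -⟩ := sc.covers G _ hcov j hj
    rw [show sc.run G _ = ∅ from hsce] at he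
    simp at he
  | case2 G C sce hsce ih =>
    have heq : setCoverLoop sc mnj V F neg G C =
        setCoverLoop sc mnj V F neg (G \ sce) (C ∪ sce) := by
      rw [setCoverLoop]
      exact if_neg hsce
    rw [heq] at h ⊢
    refine ih ?_ h
    rw [hGC, sdiff_sdiff_left]
    rfl

/-- Without forbidden edges and marked vertices the set cover algorithm deletes nothing. -/
theorem setCoverLoop_eq_empty (sc : SetCoverAlg (L × L)) (hmnj : 0 < mnj)
    (hG : ∀ e ∈ G, e.1 ∈ V ∧ e.2 ∈ V ∧ e.1 ≠ e.2) (hneg : ∀ v ∈ V, ¬ neg v) :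
    setCoverLoop sc mnj V ∅ neg G ∅ = ∅ := by
  rw [setCoverLoop]
  refine if_pos ?_
  rw [Finset.eq_empty_iff_forall_notMem]
  intro e he
  obtain ⟨j, hj, -⟩ := sc.useful _ _ e he
  simp only [coverUniverse, Finset.empty_union, Finset.biUnion_empty, Finset.mem_biUnion,
    List.mem_toFinset] at hj
  obtain ⟨v, hv, hj⟩ := hj
  exact hneg v hv ((computeJustifications_spec (neg := neg) hmnj hG).1.vertJ_mem v j hj).2

end SetCover

end Algorithms

section Repair

variable {L : Type*} [DecidableEq L] {D : DTD L}

/-! ### Traversals of the DTD graph -/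

theorem exists_mem_own_of_mem_traverse {own : List L → L → Finset (L × Finset (L × L))}
    {path : List L} {R : L} {x : L × Finset (L × L)} (h : x ∈ traverse (D := D) own path R) :
    ∃ path' R', D.Le R R' ∧ x ∈ own path' R' := by
  induction hn : (D.strictlyBelow R).card using Nat.strong_induction_on generalizing path R with
  | _ n ih =>
    rw [traverse] at h
    rcases Finset.mem_union.1 h with h | h
    · exact ⟨path, R, .refl, h⟩
    · obtain ⟨⟨B, hB⟩, -, h⟩ := Finset.mem_biUnion.1 h
      have hs := DTD.mem_children.1 hB
      obtain ⟨path', R', hle, hx⟩ := ih _ (hn ▸ DTD.card_strictlyBelow_lt hs) h rfl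
      exact ⟨path', R', .head hs hle, hx⟩

theorem exists_own_subset_traverse (own : List L → L → Finset (L × Finset (L × L)))
    {R R' : L} (h : D.Le R R') (path : List L) :
    ∃ path', own path' R' ⊆ traverse (D := D) own path R := by
  induction h using Relation.ReflTransGen.head_induction_on generalizing path with
  | refl =>
    rw [traverse]
    exact ⟨path, Finset.subset_union_left⟩
  | @head R B hs _ ih =>
    obtain ⟨path', hp⟩ := ih (R :: path)
    refine ⟨path', fun x hx => ?_⟩
    rw [traverse]
    refine Finset.mem_union_right _ (Finset.mem_biUnion.2 ⟨⟨B, DTD.mem_children.2 hs⟩, ?_, hp hx⟩)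
    simp

/-! ### Marks -/

theorem marked_of_mem_forbidden {P : Policy D} {u : UAT L} (hu : u ∈ P.forbidden) :
    Marked P u.src :=
  (marked_iff P _).2 ⟨_, .refl, u, hu, rfl⟩

theorem Marked.of_le {P : Policy D} {A B : L} (h : Marked P B) (hAB : D.Le A B) :
    Marked P A := by
  obtain ⟨C, hC, hu⟩ := (marked_iff P B).1 h
  exact (marked_iff P A).2 ⟨C, hAB.trans hC, hu⟩

/-! ### Correctness of the repair algorithms -/

theorem mem_replaceEdges {P : Policy D} {A : L} {V : List L} {e : L × L}
    (h : e ∈ replaceEdges P A V) : e.1 ∈ V ∧ e.2 ∈ V ∧ e.1 ≠ e.2 := by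
  obtain ⟨hV, ha⟩ := Finset.mem_filter.1 h
  rw [Finset.mem_product, List.mem_toFinset, List.mem_toFinset] at hV
  obtain ⟨-, l, -, -, -, hne⟩ := DTD.repl_mem_valid.1 (P.allowed_subset ha)
  exact ⟨hV.1, hV.2, hne⟩

theorem repl_mem_iff_mem_replaceEdges {P : Policy D} {A : L} {V : List L} (hr : D.rg A = .alt V)
    {X Y : L} : (X, Y) ∈ replaceEdges P A V ↔ UAT.repl A X Y ∈ P.allowed := by
  simp only [replaceEdges, Finset.mem_filter, Finset.mem_product, List.mem_toFinset,
    and_iff_right_iff_imp]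
  intro h
  obtain ⟨-, l, hl, hX, hY, -⟩ := DTD.repl_mem_valid.1 (P.allowed_subset h)
  rw [hr, Content.alt.injEq] at hl
  exact hl ▸ ⟨hX, hY⟩

theorem repl_mem_iff_mem_forbiddenEdges {P : Policy D} {A : L} {V : List L}
    (hr : D.rg A = .alt V) {X Y : L} :
    (X, Y) ∈ forbiddenEdges P A V ↔ UAT.repl A X Y ∈ P.forbidden := by
  simp only [forbiddenEdges, Finset.mem_filter, Finset.mem_product, List.mem_toFinset,
    and_iff_right_iff_imp]
  intro h
  obtain ⟨-, l, hl, hX, hY, -⟩ := DTD.repl_mem_valid.1 (P.forbidden_subset h)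
  rw [hr, Content.alt.injEq] at hl
  exact hl ▸ ⟨hX, hY⟩

/-- What a visit of a disjunction `A` with the alternatives `V` achieves by deleting the set `C` of
edges.  The last clause says that total policies are changed at marked element types only, so that
the new prohibitions of a total repair do not create new marks. -/
structure GoodVisit (P : Policy D) (A : L) (V : List L) (C : Finset (L × L)) : Prop where
  closed : ∀ X Y, Relation.TransGen (fun x y => (x, y) ∈ replaceEdges P A V \ C) X Y →
    (X ≠ Y → (X, Y) ∉ forbiddenEdges P A V ∪ C) ∧ (X = Y → ¬ Marked P X)
  unmarked : P.IsTotal → ¬ Marked P A → C = ∅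

theorem forbiddenEdges_eq_empty {P : Policy D} {A : L} (h : ¬ Marked P A) (V : List L) :
    forbiddenEdges P A V = ∅ := by
  rw [Finset.eq_empty_iff_forall_notMem]
  intro e he
  exact h (marked_of_mem_forbidden (Finset.mem_filter.1 he).2)

theorem not_marked_of_mem {P : Policy D} {A : L} (hA : A ∈ D.ele) {V : List L}
    (hr : D.rg A = .alt V) (h : ¬ Marked P A) : ∀ v ∈ V, ¬ Marked P v := fun v hv hm =>
  h (hm.of_le (.single ⟨hA, by rw [hr]; exact hv⟩))

theorem goodVisit_naive (P : Policy D) {A : L} (hA : A ∈ D.ele) {V : List L}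
    (hr : D.rg A = .alt V) (pick : Finset (L × L) → L → L → L → Bool) :
    GoodVisit P A V (naiveLoop V (replaceEdges P A V) (Marked P) pick V ∅) where
  closed X Y h := by
    have hspec := naiveLoop_spec (V := V) (G := replaceEdges P A V) (neg := Marked P) (pick := pick)
      (fun e he => ⟨(mem_replaceEdges he).1, (mem_replaceEdges he).2.1⟩) V ∅
      (fun Y hY hY' => absurd hY hY')
    generalize naiveLoop V (replaceEdges P A V) (Marked P) pick V ∅ = C at h hspec
    have hE := transGen_of_trans_of_ne (fun x y z h1 h2 hne => by
      by_contra hxz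
      exact hspec x y z ⟨⟨h1, h2⟩, .inl ⟨hne, hxz⟩⟩) h
    constructor
    · intro hne
      obtain ⟨hG, hC⟩ := Finset.mem_sdiff.1 (hE.resolve_right fun h => hne h.1)
      rw [Finset.mem_union, not_or]
      refine ⟨fun hF => ?_, hC⟩
      exact Finset.disjoint_left.1 P.disjoint (Finset.mem_filter.1 hG).2 (Finset.mem_filter.1 hF).2
    · rintro rfl hneg
      rcases hE with hE | ⟨-, y, h1, h2⟩
      · exact (mem_replaceEdges (Finset.mem_sdiff.1 hE).1).2.2 rfl
      · exact hspec X y X ⟨⟨h1, h2⟩, .inr ⟨rfl, hneg⟩⟩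
  unmarked hP hm := by
    refine naiveLoop_eq_self ?_ V
    rintro X Y Z ⟨⟨h1, h2⟩, h3⟩
    rw [Finset.sdiff_empty] at h1 h2 h3
    have hX := (mem_replaceEdges h1).1
    have hZ := (mem_replaceEdges h2).2.1
    rcases h3 with ⟨hne, h3⟩ | ⟨-, h3⟩
    · have hv : UAT.repl A X Z ∈ D.valid := DTD.repl_mem_valid.2 ⟨hA, V, hr, hX, hZ, hne⟩
      rw [← hP, Finset.mem_union] at hv
      rcases hv with hv | hv
      · exact h3 ((repl_mem_iff_mem_replaceEdges hr).2 hv)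
      · exact hm (marked_of_mem_forbidden hv)
    · exact not_marked_of_mem hA hr hm X hX h3

theorem goodVisit_setCover (P : Policy D) {A : L} (hA : A ∈ D.ele) {V : List L}
    (hr : D.rg A = .alt V) (sc : SetCoverAlg (L × L)) {mnj : ℕ} (hmnj : 0 < mnj) :
    GoodVisit P A V (setCoverLoop sc mnj V (forbiddenEdges P A V) (Marked P)
      (replaceEdges P A V) ∅) where
  closed X Y h := setCoverLoop_spec sc hmnj (fun e he => mem_replaceEdges he) _ _ (by simp) h
  unmarked _ hm := by
    rw [forbiddenEdges_eq_empty hm]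
    exact setCoverLoop_eq_empty sc hmnj (fun e he => mem_replaceEdges he)
      (not_marked_of_mem hA hr hm)

/-- The visits of ReplaceRepair, with the sets of edges deleted at them. -/
noncomputable def replaceVisits (P : Policy D) (mnj : ℕ) (ch : Choices L) :
    Finset (L × Finset (L × L)) :=
  if mnj = 0 then replaceNaive P ch.naive else replaceSetCover P ch.setCover mnj

theorem goodVisit_of_mem_replaceVisits {P : Policy D} {mnj : ℕ} {ch : Choices L} {A : L}
    {C : Finset (L × L)} (h : (A, C) ∈ replaceVisits P mnj ch) :
    ∃ V, D.rg A = .alt V ∧ GoodVisit P A V C := by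
  unfold replaceVisits at h
  split_ifs at h with hm
  · obtain ⟨path, R, hle, hx⟩ := exists_mem_own_of_mem_traverse h
    have hR := hle.mem_ele D.root_mem
    split at hx
    case h_1 V hr =>
      obtain ⟨rfl, rfl⟩ := Prod.mk.injEq _ _ _ _ ▸ Finset.mem_singleton.1 hx
      exact ⟨V, hr, goodVisit_naive P hR hr _⟩
    case h_2 => simp at hx
  · obtain ⟨path, R, hle, hx⟩ := exists_mem_own_of_mem_traverse h
    have hR := hle.mem_ele D.root_mem
    split at hx
    case h_1 V hr =>
      obtain ⟨rfl, rfl⟩ := Prod.mk.injEq _ _ _ _ ▸ Finset.mem_singleton.1 hx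
      exact ⟨V, hr, goodVisit_setCover P hR hr _ (Nat.pos_of_ne_zero hm)⟩
    case h_2 => simp at hx

theorem exists_mem_replaceVisits (P : Policy D) (mnj : ℕ) (ch : Choices L) {A : L}
    (hA : D.Le D.root A) {V : List L} (hr : D.rg A = .alt V) :
    ∃ C, (A, C) ∈ replaceVisits P mnj ch := by
  unfold replaceVisits
  split_ifs with hm
  · obtain ⟨path, hp⟩ := exists_own_subset_traverse (D := D) (fun path R =>
      match D.rg R with
      | .alt V => {(R, naiveLoop V (replaceEdges P R V) (Marked P) (ch.naive path R) V ∅)}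
      | _ => ∅) hA []
    simp only [hr] at hp
    exact ⟨_, hp (Finset.mem_singleton_self _)⟩
  · obtain ⟨path, hp⟩ := exists_own_subset_traverse (D := D) (fun _ R =>
      match D.rg R with
      | .alt V => {(R, setCoverLoop ch.setCover mnj V (forbiddenEdges P R V) (Marked P)
          (replaceEdges P R V) ∅)}
      | _ => ∅) hA []
    simp only [hr] at hp
    exact ⟨_, hp (Finset.mem_singleton_self _)⟩

theorem mem_replaceRepair {P : Policy D} {mnj : ℕ} {ch : Choices L} {u : UAT L} :
    u ∈ replaceRepair P mnj ch ↔
      ∃ A C X Y, (A, C) ∈ replaceVisits P mnj ch ∧ (X, Y) ∈ C ∧ u = .repl A X Y := by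
  change u ∈ (replaceVisits P mnj ch).biUnion _ ↔ _
  simp only [Finset.mem_biUnion, Finset.mem_image, Prod.exists]
  constructor
  · rintro ⟨A, C, h, X, Y, hXY, rfl⟩
    exact ⟨A, C, X, Y, h, hXY, rfl⟩
  · rintro ⟨A, C, X, Y, h, hXY, rfl⟩
    exact ⟨A, C, h, X, Y, hXY, rfl⟩

theorem mem_insDelRepair {P : Policy D} {pick : L → Bool} {u : UAT L} :
    u ∈ insDelRepair P pick ↔ ∃ A ∈ D.ele, ∃ B ∈ D.children A, Flagged P A ∧
      u = if pick A then .ins A B else .del A B := by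
  simp only [insDelRepair, Finset.mem_biUnion, List.mem_toFinset]
  refine exists_congr fun A => and_congr_right fun _ => exists_congr fun B =>
    and_congr_right fun _ => ?_
  by_cases hf : Flagged P A <;> simp [hf]

/-- The repair algorithm changes a total policy at marked element types only. -/
theorem marked_of_mem_changes {P : Policy D} (hP : P.IsTotal) {mnj : ℕ} {ch : Choices L}
    {u : UAT L} (hu : u ∈ changes P mnj ch) : Marked P u.src := by
  rcases Finset.mem_union.1 hu with hu | hu
  · obtain ⟨A, -, B, -, hf, rfl⟩ := mem_insDelRepair.1 hu
    split_ifs <;> exact hf.1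
  · obtain ⟨A, C, X, Y, hv, hXY, rfl⟩ := mem_replaceRepair.1 hu
    obtain ⟨V, -, hg⟩ := goodVisit_of_mem_replaceVisits hv
    by_contra hm
    rw [hg.unmarked hP hm] at hXY
    simp at hXY

/-- The edges left by the repair algorithm are contained in what is left by each single visit. -/
theorem transGen_visit {P : Policy D} {mnj : ℕ} {ch : Choices L} {A : L} {C : Finset (L × L)}
    (hv : (A, C) ∈ replaceVisits P mnj ch) {V : List L} (hr : D.rg A = .alt V) {X Y : L}
    (h : Relation.TransGen (fun X Y => UAT.repl A X Y ∈ P.allowed \ changes P mnj ch) X Y) :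
    Relation.TransGen (fun x y => (x, y) ∈ replaceEdges P A V \ C) X Y := by
  refine h.lift id fun x y hxy => ?_
  obtain ⟨ha, hc⟩ := Finset.mem_sdiff.1 hxy
  refine Finset.mem_sdiff.2 ⟨(repl_mem_iff_mem_replaceEdges hr).2 ha, fun hC => hc ?_⟩
  exact Finset.mem_union_right _ (mem_replaceRepair.2 ⟨A, C, x, y, hv, hC, rfl⟩)

/-- What the repair algorithm leaves satisfies the local conditions for consistency, with any set of
prohibitions that consists of the old ones and of removed update access types at marked element
types. -/
theorem locallyConsistent_sdiff_changes (P : Policy D) (mnj : ℕ) (ch : Choices L)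
    {F : Finset (UAT L)} (hF : F ⊆ D.valid)
    (h : ∀ u ∈ F, u ∈ P.forbidden ∨ (u ∈ changes P mnj ch ∧ Marked P u.src)) :
    LocallyConsistent D (P.allowed \ changes P mnj ch) F := by
  have hbelow : ∀ A, Below D F A → Marked P A := by
    rintro A ⟨u, hu, hle⟩
    exact ((h u hu).elim marked_of_mem_forbidden And.right).of_le hle
  have hsub : P.allowed \ changes P mnj ch ⊆ D.valid :=
    Finset.sdiff_subset.trans P.allowed_subset
  have halt : ∀ A X Y,
      Relation.TransGen (fun X Y => UAT.repl A X Y ∈ P.allowed \ changes P mnj ch) X Y →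
      ∃ V, D.rg A = .alt V := by
    intro A X Y h
    obtain ⟨Z, hZ, -⟩ := Relation.TransGen.head'_iff.1 h
    obtain ⟨-, l, hl, -⟩ := DTD.repl_mem_valid.1 (hsub hZ)
    exact ⟨l, hl⟩
  refine ⟨hsub, hF, ?_, ?_, ?_, ?_⟩
  · rw [Finset.disjoint_left]
    intro u hu hu'
    obtain ⟨ha, hc⟩ := Finset.mem_sdiff.1 hu
    rcases h u hu' with h | h
    · exact Finset.disjoint_left.1 P.disjoint ha h
    · exact hc h.1
  · intro A B hb hi hd
    obtain ⟨hi, hi'⟩ := Finset.mem_sdiff.1 hi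
    obtain ⟨hd, hd'⟩ := Finset.mem_sdiff.1 hd
    obtain ⟨hA, hr⟩ := DTD.ins_mem_valid.1 (P.allowed_subset hi)
    have hB : B ∈ D.children A := DTD.mem_children.2 ⟨hA, by simp [hr, Content.subs]⟩
    have hm := (mem_insDelRepair (pick := ch.insDel)).2 ⟨A, hA, B, hB,
      ⟨hbelow A hb, B, hB, hi, hd⟩, rfl⟩
    have := Finset.mem_union_left (replaceRepair P mnj ch) hm
    split_ifs at this
    · exact hi' this
    · exact hd' this
  · intro A hle X Y ht hu
    obtain ⟨V, hr⟩ := halt A X Y ht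
    have hne : X ≠ Y := by
      obtain ⟨-, _, -, -, -, hne⟩ := DTD.repl_mem_valid.1 (hF hu)
      exact hne
    -- No visit of `A` deletes `(X, Y)`: after each of them the edges that are left in the end still
    -- form a path from `X` to `Y`.
    have hnot : ∀ C, (A, C) ∈ replaceVisits P mnj ch → (X, Y) ∉ forbiddenEdges P A V ∪ C := by
      intro C hv
      obtain ⟨V', hr', hg⟩ := goodVisit_of_mem_replaceVisits hv
      rw [hr, Content.alt.injEq] at hr'
      subst hr'
      exact (hg.closed X Y (transGen_visit hv hr ht)).1 hne
    rcases h _ hu with hu | ⟨hu, -⟩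
    · obtain ⟨C, hC⟩ := exists_mem_replaceVisits P mnj ch hle hr
      exact hnot C hC (Finset.mem_union_left _ ((repl_mem_iff_mem_forbiddenEdges hr).2 hu))
    · rcases Finset.mem_union.1 hu with hu | hu
      · obtain ⟨A', -, B, -, -, he⟩ := mem_insDelRepair.1 hu
        split_ifs at he
      · obtain ⟨A', C, X', Y', hv, hXY, he⟩ := mem_replaceRepair.1 hu
        obtain ⟨rfl, rfl, rfl⟩ := UAT.repl.injEq _ _ _ _ _ _ ▸ he
        exact hnot C hv (Finset.mem_union_right _ hXY)
  · intro A hle X hb ht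
    obtain ⟨V, hr⟩ := halt A X X ht
    obtain ⟨C, hv⟩ := exists_mem_replaceVisits P mnj ch hle hr
    obtain ⟨V', hr', hg⟩ := goodVisit_of_mem_replaceVisits hv
    rw [hr, Content.alt.injEq] at hr'
    subst hr'
    exact (hg.closed X X (transGen_visit hv hr ht)).2 rfl (hbelow X hb)

theorem repair_le (P : Policy D) (mnj : ℕ) (ch : Choices L) (total : Bool) :
    repair P mnj ch total ≤ P :=
  Finset.sdiff_subset (s := P.allowed)

theorem repair_total_consistent {P : Policy D} (hP : P.IsTotal) (mnj : ℕ) (ch : Choices L) :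
    (repair P mnj ch true).Consistent := by
  refine LocallyConsistent.consistent (locallyConsistent_sdiff_changes P mnj ch
    (repair P mnj ch true).forbidden_subset fun u hu => ?_)
  obtain ⟨hv, hu⟩ := Finset.mem_sdiff.1 (hu : u ∈ D.valid \ (P.allowed \ changes P mnj ch))
  by_cases hc : u ∈ changes P mnj ch
  · exact .inr ⟨hc, marked_of_mem_changes hP hc⟩
  · rw [← hP, Finset.mem_union] at hv
    exact .inl (hv.resolve_left fun ha => hu (Finset.mem_sdiff.2 ⟨ha, hc⟩))

theorem repair_partial_consistent (P : Policy D) (mnj : ℕ) (ch : Choices L) :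
    (repair P mnj ch false).Consistent :=
  LocallyConsistent.consistent (locallyConsistent_sdiff_changes P mnj ch
    (repair P mnj ch false).forbidden_subset fun _ hu => .inl hu)

/-- If the prohibitions of a partial policy were all that is not allowed after a repair, then the
repair would have removed nothing, and the policy would be total. -/
theorem repair_partial_forbidden_ne {P : Policy D} (hP : P.IsPartial) (mnj : ℕ) (ch : Choices L) :
    (repair P mnj ch false).forbidden ≠ D.valid \ (repair P mnj ch false).allowed := by
  intro h
  refine hP (Finset.Subset.antisymm (Finset.union_subset P.allowed_subset P.forbidden_subset) ?_)
  intro u hu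
  by_cases ha : u ∈ (repair P mnj ch false).allowed
  · exact Finset.mem_union_left _ (repair_le P mnj ch false ha)
  · have : u ∈ (repair P mnj ch false).forbidden := h ▸ Finset.mem_sdiff.2 ⟨hu, ha⟩
    exact Finset.mem_union_right _ this

end Repair

end XMLRepair

theorem mainTheorem6 {L : Type*} [DecidableEq L] (D : XMLRepair.DTD L) (P : XMLRepair.Policy D)
    (mnj : ℕ) (ch : XMLRepair.Choices L) :
    (P.IsTotal → (XMLRepair.repair P mnj ch true).IsTotalRepairOf P) ∧
    (P.IsPartial → (XMLRepair.repair P mnj ch false).IsPartialRepairOf P ∧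
      (XMLRepair.repair P mnj ch false).forbidden = P.forbidden) ∧
    (∀ total : Bool, (XMLRepair.repair P mnj ch total).allowed =
      P.allowed \ (XMLRepair.insDelRepair P ch.insDel ∪ XMLRepair.replaceRepair P mnj ch)) := by
  refine ⟨fun hP => ⟨⟨?_, ?_⟩, rfl⟩, fun hP => ⟨⟨⟨?_, ?_⟩, ?_⟩, rfl⟩, fun _ => rfl⟩
  · exact XMLRepair.repair_total_consistent hP mnj ch
  · exact XMLRepair.repair_le P mnj ch true
  · exact XMLRepair.repair_partial_consistent P mnj ch
  · exact XMLRepair.repair_le P mnj ch false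
  · exact XMLRepair.repair_partial_forbidden_ne hP mnj ch
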